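/- Fix an integer $d\ge 2$. Let $\mathbf n=\mathbf e_1+\dots+\mathbf e_{d+1}\in\mathbb Z^{d+1}$, let $X^d=\mathbb Z^{d+1}/\mathbb Z\mathbf n$, made into a graph by joining $[\mathbf x]$ to $[\mathbf x\pm\mathbf e_i]$ for $1\le i\le d+1$, with graph distance $\operatorname{dist}$. Let $H=\mathbf n^\perp\subset\mathbb R^{d+1}$, let $P$ be the orthogonal projection onto $H$, identify $[\mathbf x]\in X^d$ with $P\mathbf x\in H$, and put $\mathbf g_i=P\mathbf e_i$. Let $\Omega$ be the set of height functions, that is, of functions $f:X^d\to\mathbb Z$ with $f(0)\in(d+1)\mathbb Z$ and $f(x+\mathbf g_i)-f(x)\in\{1,-d\}$ for all $x\in X^d$ and all $i$. For finite $R\subset X^d$ and $f\in\Omega$ let $\Omega(R,f)$ be the finite set of those $g\in\Omega$ that agree with $f$ outside $R$. Let $\mathcal S=\{s\in H^*:\max_i s(\mathbf g_i)\le 1\}$, and for $s\in\mathcal S$ let $\lfloor s\rfloor$ be the largest height function $g$ with $g\le s|_{X^d}$. Let $\Pi_n=\{a_1\mathbf g_1+\dots+a_d\mathbf g_d: a_i\in\mathbb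 Z,\ -n\le a_i<n\}$. The surface tension at $s\in\mathcal S$ is $$\sigma(s)=\lim_{n\to\infty}-\frac1{|\Pi_n|}\log|\Omega(\Pi_n,\lfloor s\rfloor)|.$$ Let $\mathcal F^\nabla$ be the $\sigma$-algebra on $\Omega$ generated by the differences $f(x)-f(y)$, $x,y\in X^d$. For a probability measure $\mu$ on $(\Omega,\mathcal F^\nabla)$ and a finite set $R\subset X^d$, write $D_Rf=(f(y)-f(x))_{x,y\in R}$, a map on $\Omega$ with finite image, and $$\mathcal H_R(\mu)=\sum_{z\in\operatorname{Im}D_R}\mu(D_Rf=z)\log\mu(D_Rf=z)$$ (with $0\log 0=0$). The specific entropy of $\mu$ is $\mathcal H(\mu)=\lim_{n\to\infty}|\Pi_n|^{-1}\mathcal H_{\Pi_n}(\mu)$ if this limit exists, and the corresponding limit inferior otherwise. **Theorem.** Let $s\in\mathcal S$, and let $\mu$ be a probability measure on $(\Omega,\mathcal F^\nabla)$ that is * shift-invariant: $\mu(\tilde\theta_xA)=\mu(A)$ for all $x\in X^d$ and $A\in\mathcal F^\nabla$, where $\tilde\theta_xf=f(\cdot+x)-f(x)+f(0)$; * a gradient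 Gibbs measure: $\mu(A)=\int\frac{|\Omega(R,f)\cap A|}{|\Omega(R,f)|}\,d\mu(f)$ for every finite $R\subset X^d$ and every $A\in\mathcal F^\nabla$; * of slope $s$: $\int(f(x)-f(0))\,d\mu=s(x)$ for all $x\in X^d$; * concentrated: for all $x,y\in X^d$ and $n=\operatorname{dist}(x,y)$, we have $\operatorname{Var}_\mu(f(y)-f(x))\le(d+1)^2n$, and, if $n>0$, also $\mu(f(y)-f(x)-s(y-x)\ge(d+1)a)\le e^{-a^2/(2n)}$ for all $a\ge0$ and $\mu(f(y)-f(x)-s(y-x)\le(d+1)a)\le e^{-a^2/(2n)}$ for all $a\le0$. Then the limit defining $\sigma(s)$ exists, and $\mathcal H(\mu)=\sigma(s)$. -/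

import Mathlib

open MeasureTheory Filter Topology
open scoped ENNReal

noncomputable section

namespace Stepped

/-- The vertex set `X^d = ℤ^{d+1} / ℤ𝐧` of the simplicial lattice, `𝐧 = 𝐞₁ + ⋯ + 𝐞_{d+1}`. -/
abbrev Vertex (d : ℕ) : Type :=
  (Fin (d + 1) → ℤ) ⧸ AddSubgroup.zmultiples (1 : Fin (d + 1) → ℤ)

/-- The class `[𝐱]` of `𝐱 ∈ ℤ^{d+1}`. -/
abbrev cls {d : ℕ} (x : Fin (d + 1) → ℤ) : Vertex d := QuotientAddGroup.mk x

/-- The generator `[𝐞ᵢ]` of `X^d`. -/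
def gen {d : ℕ} (i : Fin (d + 1)) : Vertex d := cls (Pi.single i 1)

/-- The simplicial lattice `(X^d, E^d)`: the neighbours of `x` are the vertices `x ± [𝐞ᵢ]`. -/
def latticeGraph (d : ℕ) : SimpleGraph (Vertex d) :=
  SimpleGraph.fromRel fun x y => ∃ i, y = x + gen i

/-- The hyperplane `H ⊆ ℝ^{d+1}`, the orthogonal complement of `𝐧`. -/
def Hyperplane (d : ℕ) : Submodule ℝ (Fin (d + 1) → ℝ) :=
  LinearMap.ker (∑ i : Fin (d + 1), LinearMap.proj (R := ℝ) (φ := fun _ => ℝ) i)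

lemma mem_hyperplane {d : ℕ} (v : Fin (d + 1) → ℝ) :
    v ∈ Hyperplane d ↔ ∑ i, v i = 0 := by
  simp [Hyperplane]

/-- The orthogonal projection `P 𝐱 = 𝐱 - ((𝐱, 𝐧) / (d+1)) 𝐧` onto `H`, on integer points. -/
def projInt (d : ℕ) : (Fin (d + 1) → ℤ) →+ Hyperplane d where
  toFun x := ⟨fun i => (x i : ℝ) - (∑ j, (x j : ℝ)) / (d + 1), by
    have h : (d : ℝ) + 1 ≠ 0 := by positivity
    rw [mem_hyperplane]
    simp only [Finset.sum_sub_distrib, Finset.sum_const, Finset.card_univ, Fintype.card_fin,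
      nsmul_eq_mul, Nat.cast_add, Nat.cast_one]
    field_simp
    ring⟩
  map_zero' := by ext i; simp
  map_add' x y := by
    ext i
    simp only [Pi.add_apply, Int.cast_add, Finset.sum_add_distrib, Submodule.coe_add]
    ring

/-- The identification of `X^d` with a subset of `H`, `[𝐱] ↦ P 𝐱`. -/
def embed (d : ℕ) : Vertex d →+ Hyperplane d :=
  QuotientAddGroup.lift _ (projInt d) (by
    refine AddSubgroup.zmultiples_le_of_mem ?_
    rw [AddMonoidHom.mem_ker]
    have h : (d : ℝ) + 1 ≠ 0 := by positivity
    ext i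
    simp [projInt, h])

/-- Slopes: linear forms on `H`. -/
abbrev Slope (d : ℕ) : Type := Module.Dual ℝ (Hyperplane d)

/-- The set `𝒮` of Lipschitz slopes, `maxᵢ s(𝐠ᵢ) ≤ 1` where `𝐠ᵢ = P 𝐞ᵢ`. -/
def lipSlopes (d : ℕ) : Set (Slope d) := {s | ∀ i, s (embed d (gen i)) ≤ 1}

/-- The set `Ω` of height functions. -/
@[ext] structure HeightFunction (d : ℕ) where
  toFun : Vertex d → ℤ
  dvd_zero : ((d : ℤ) + 1) ∣ toFun 0
  grad : ∀ x i, toFun (x + gen i) - toFun x = 1 ∨ toFun (x + gen i) - toFun x = -(d : ℤ)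

instance (d : ℕ) : CoeFun (HeightFunction d) (fun _ => Vertex d → ℤ) := ⟨HeightFunction.toFun⟩

/-- The shift `θ̃ₓ f = f(· + x) - f(x) + f(0)`. -/
def shift {d : ℕ} (x : Vertex d) (f : HeightFunction d) : HeightFunction d where
  toFun y := f (y + x) - f x + f 0
  dvd_zero := by simpa using f.dvd_zero
  grad y i := by
    have h := f.grad (y + x) i
    rw [show y + gen i + x = y + x + gen i by abel]
    omega

/-- `Ω(R, f)`: the height functions that agree with `f` outside `R`. -/
def fixedBdry {d : ℕ} (R : Set (Vertex d)) (f : HeightFunction d) : Set (HeightFunction d) :=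
  {g | ∀ x ∉ R, g x = f x}

/-! ### The height function `⌊F⌋` -/

/-- The residue `(𝐱, 𝐧) mod d + 1` of a vertex `[𝐱]`. -/
def residue (d : ℕ) : Vertex d →+ ZMod (d + 1) :=
  QuotientAddGroup.lift _
    (AddMonoidHom.mk' (fun x : Fin (d + 1) → ℤ => ((∑ i, x i : ℤ) : ZMod (d + 1)))
      (fun x y => by simp [Finset.sum_add_distrib]))
    (by
      refine AddSubgroup.zmultiples_le_of_mem ?_
      rw [AddMonoidHom.mem_ker]
      simp)

lemma residue_gen {d : ℕ} (i : Fin (d + 1)) : residue d (gen i) = 1 := by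
  change ((∑ j, (Pi.single i 1 : Fin (d + 1) → ℤ) j : ℤ) : ZMod (d + 1)) = 1
  simp

lemma sum_gen (d : ℕ) : ∑ i : Fin (d + 1), (gen i : Vertex d) = 0 := by
  have h : ∑ i : Fin (d + 1), (gen i : Vertex d)
      = QuotientAddGroup.mk' (AddSubgroup.zmultiples (1 : Fin (d + 1) → ℤ))
          (∑ i, Pi.single i (1 : ℤ)) := by
    rw [map_sum]; rfl
  rw [h, QuotientAddGroup.mk'_apply, QuotientAddGroup.eq_zero_iff]
  have : (∑ i : Fin (d + 1), Pi.single i (1 : ℤ)) = (1 : Fin (d + 1) → ℤ) :=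
    Finset.univ_sum_single (1 : Fin (d + 1) → ℤ)
  rw [this]
  exact AddSubgroup.mem_zmultiples _

/-- The Lipschitz condition `F(x + [𝐞ᵢ]) ≤ F(x) + 1` for functions on `X^d`. -/
def IsLip {d : ℕ} (F : Vertex d → ℝ) : Prop := ∀ x i, F (x + gen i) ≤ F x + 1

lemma IsLip.sum_le {d : ℕ} {F : Vertex d → ℝ} (hF : IsLip F) (x : Vertex d)
    (A : Finset (Fin (d + 1))) : F (x + ∑ j ∈ A, gen j) ≤ F x + A.card := by
  classical
  induction A using Finset.induction_on with
  | empty => simp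
  | insert a A ha ih =>
    rw [Finset.sum_insert ha, Finset.card_insert_of_notMem ha,
      show x + (gen a + ∑ j ∈ A, gen j) = x + ∑ j ∈ A, gen j + gen a by abel]
    have := hF (x + ∑ j ∈ A, gen j) a
    push_cast
    linarith

lemma IsLip.le_add {d : ℕ} {F : Vertex d → ℝ} (hF : IsLip F) (x : Vertex d) (i : Fin (d + 1)) :
    F x ≤ F (x + gen i) + d := by
  classical
  have h := hF.sum_le (x + gen i) (Finset.univ.erase i)
  rw [add_assoc, Finset.add_sum_erase _ _ (Finset.mem_univ i), sum_gen, add_zero] at h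
  simpa using h

/-- The largest integer `k ≤ F(x)` that has the residue of `x` modulo `d + 1`. -/
def floorVal {d : ℕ} (F : Vertex d → ℝ) (x : Vertex d) : ℤ :=
  ⌊F x⌋ - ((((⌊F x⌋ : ℤ) : ZMod (d + 1)) - residue d x).val : ℤ)

lemma floorVal_cast {d : ℕ} (F : Vertex d → ℝ) (x : Vertex d) :
    ((floorVal F x : ℤ) : ZMod (d + 1)) = residue d x := by
  simp [floorVal]

lemma floorVal_le {d : ℕ} (F : Vertex d → ℝ) (x : Vertex d) : (floorVal F x : ℝ) ≤ F x := by
  refine le_trans ?_ (Int.floor_le (F x))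
  have : floorVal F x ≤ ⌊F x⌋ := by unfold floorVal; omega
  exact_mod_cast this

lemma lt_floorVal {d : ℕ} (F : Vertex d → ℝ) (x : Vertex d) :
    F x < floorVal F x + (d + 1) := by
  have h1 : ⌊F x⌋ + 1 ≤ floorVal F x + (d + 1) := by
    have := ZMod.val_lt (((⌊F x⌋ : ℤ) : ZMod (d + 1)) - residue d x)
    unfold floorVal
    omega
  have h2 := Int.lt_floor_add_one (F x)
  have h3 : ((⌊F x⌋ : ℝ) + 1) ≤ floorVal F x + (d + 1) := by exact_mod_cast h1
  linarith

/-- The height function `⌊F⌋` of a Lipschitz function `F`: see `lipFloor_isGreatest`. -/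
def lipFloor {d : ℕ} (F : Vertex d → ℝ) (hF : IsLip F) : HeightFunction d where
  toFun := floorVal F
  dvd_zero := by
    have h := floorVal_cast F 0
    rw [map_zero, ZMod.intCast_zmod_eq_zero_iff_dvd] at h
    exact_mod_cast h
  grad x i := by
    have h : ((floorVal F (x + gen i) - (floorVal F x + 1) : ℤ) : ZMod (d + 1)) = 0 := by
      push_cast
      rw [floorVal_cast, floorVal_cast, map_add, residue_gen, sub_self]
    rw [ZMod.intCast_zmod_eq_zero_iff_dvd] at h
    obtain ⟨t, ht⟩ := h
    push_cast at ht
    have a1 := floorVal_le F (x + gen i)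
    have a2 := lt_floorVal F (x + gen i)
    have a3 := floorVal_le F x
    have a4 := lt_floorVal F x
    have a5 := hF x i
    have a6 := hF.le_add x i
    have b1 : floorVal F (x + gen i) - (floorVal F x + 1) < (d : ℤ) + 1 := by
      have : (floorVal F (x + gen i) : ℝ) - (floorVal F x + 1) < (d : ℝ) + 1 := by linarith
      exact_mod_cast this
    have b2 : -2 * ((d : ℤ) + 1) < floorVal F (x + gen i) - (floorVal F x + 1) := by
      have : -2 * ((d : ℝ) + 1) < (floorVal F (x + gen i) : ℝ) - (floorVal F x + 1) := by linarith
      exact_mod_cast this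
    rw [ht] at b1 b2
    have c1 : t < 1 := by nlinarith
    have c2 : -2 < t := by nlinarith
    obtain rfl | rfl : t = 0 ∨ t = -1 := by omega
    · left; linarith
    · right; linarith

lemma HeightFunction.cast_eq_residue {d : ℕ} (g : HeightFunction d) (x : Vertex d) :
    ((g x : ℤ) : ZMod (d + 1)) = residue d x := by
  have hd : ((d : ZMod (d + 1)) + 1) = 0 := by exact_mod_cast ZMod.natCast_self (d + 1)
  have step : ∀ y i, ((g (y + gen i) : ℤ) : ZMod (d + 1)) = (g y : ℤ) + 1 := by
    intro y i
    rcases g.grad y i with h | h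
    · rw [sub_eq_iff_eq_add.mp h]; push_cast; ring
    · rw [sub_eq_iff_eq_add.mp h]; push_cast; linear_combination -hd
  have stepz : ∀ (k : ℤ) y i, ((g (y + k • gen i) : ℤ) : ZMod (d + 1)) = (g y : ℤ) + k := by
    intro k y i
    induction k using Int.induction_on with
    | zero => simp
    | succ n ih =>
      have := step (y + (n : ℤ) • gen i) i
      rw [add_one_zsmul, ← add_assoc, this, ih]; push_cast; ring
    | pred n ih =>
      have := step (y + (-(n : ℤ) - 1) • gen i) i
      rw [add_assoc, ← add_one_zsmul, sub_add_cancel, ih] at this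
      push_cast at this ⊢
      linear_combination -this
  have key : ∀ (v : Fin (d + 1) → ℤ) (A : Finset (Fin (d + 1))),
      ((g (∑ i ∈ A, v i • gen i) : ℤ) : ZMod (d + 1)) = residue d (∑ i ∈ A, v i • gen i) := by
    classical
    intro v A
    induction A using Finset.induction_on with
    | empty =>
      rw [Finset.sum_empty, map_zero, ZMod.intCast_zmod_eq_zero_iff_dvd]
      exact_mod_cast g.dvd_zero
    | insert a A ha ih =>
      rw [Finset.sum_insert ha, add_comm (v a • gen a), stepz, ih, map_add, map_zsmul, residue_gen]
      simp
  induction x using QuotientAddGroup.induction_on with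
  | H v =>
    have hv : (QuotientAddGroup.mk v : Vertex d) = ∑ i, v i • gen i := by
      have : v = ∑ i, v i • (Pi.single i (1 : ℤ) : Fin (d + 1) → ℤ) := by
        ext j; simp [Finset.sum_apply, Pi.single_apply]
      conv_lhs => rw [this]
      rw [← QuotientAddGroup.mk'_apply, map_sum]
      rfl
    rw [hv]
    exact key v _

/-- `⌊F⌋` is the largest height function below `F`. -/
lemma lipFloor_isGreatest {d : ℕ} (F : Vertex d → ℝ) (hF : IsLip F) :
    (∀ x, (lipFloor F hF x : ℝ) ≤ F x) ∧
      ∀ g : HeightFunction d, (∀ x, (g x : ℝ) ≤ F x) → ∀ x, g x ≤ lipFloor F hF x := by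
  refine ⟨floorVal_le F, fun g hg x => ?_⟩
  change g x ≤ floorVal F x
  have h : ((g x - floorVal F x : ℤ) : ZMod (d + 1)) = 0 := by
    push_cast
    rw [g.cast_eq_residue, floorVal_cast, sub_self]
  rw [ZMod.intCast_zmod_eq_zero_iff_dvd] at h
  obtain ⟨t, ht⟩ := h
  push_cast at ht
  have h1 : g x < floorVal F x + ((d : ℤ) + 1) := by
    have : (g x : ℝ) < floorVal F x + ((d : ℝ) + 1) := (hg x).trans_lt (lt_floorVal F x)
    exact_mod_cast this
  have : t < 1 := by nlinarith
  nlinarith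

lemma isLip_of_mem {d : ℕ} {s : Slope d} (hs : s ∈ lipSlopes d) :
    IsLip fun x => s (embed d x) := by
  intro x i
  have := hs i
  simp only [map_add]
  linarith

/-! ### The surface tension -/

open Classical in
/-- The centred box `Πₙ = {a₁𝐠₁ + ⋯ + a_d𝐠_d : -n ≤ a₁, …, a_d < n}`. -/
def box (d n : ℕ) : Finset (Vertex d) :=
  (Fintype.piFinset fun _ : Fin d => Finset.Ico (-(n : ℤ)) n).image
    fun a => ∑ i, a i • gen i.castSucc

/-- `-|Πₙ|⁻¹ log |Ω(Πₙ, ⌊s⌋)|`. -/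
def tensionSeq {d : ℕ} (s : Slope d) (hs : s ∈ lipSlopes d) (n : ℕ) : ℝ :=
  -(1 / ((box d n).card : ℝ)) *
    Real.log ((fixedBdry (box d n : Set (Vertex d))
      (lipFloor (fun x => s (embed d x)) (isLip_of_mem hs))).ncard : ℝ)

/-- The surface tension `σ(s) = lim -|Πₙ|⁻¹ log |Ω(Πₙ, ⌊s⌋)|`. -/
def surfaceTension {d : ℕ} (s : Slope d) (hs : s ∈ lipSlopes d) : ℝ :=
  limUnder atTop (tensionSeq s hs)

/-! ### Gradient Gibbs measures -/

/-- The σ-algebra `ℱ^∇` generated by the differences `f(x) - f(y)`. Measures on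
`HeightFunction d` are therefore gradient measures. -/
instance gradSigma (d : ℕ) : MeasurableSpace (HeightFunction d) :=
  ⨆ (x : Vertex d) (y : Vertex d),
    MeasurableSpace.comap (fun f : HeightFunction d => f x - f y) ⊤

/-- `γ_R(A, f)`: the probability of `A` for a uniformly random element of `Ω(R, f)`. -/
def gibbsKernel {d : ℕ} (R : Finset (Vertex d)) (A : Set (HeightFunction d))
    (f : HeightFunction d) : ℝ≥0∞ :=
  ((fixedBdry (R : Set (Vertex d)) f ∩ A).ncard : ℝ≥0∞) /
    ((fixedBdry (R : Set (Vertex d)) f).ncard : ℝ≥0∞)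

/-- The DLR equations `μ = μ γ_R` on `ℱ^∇` for all finite `R`. -/
def IsGradientGibbs {d : ℕ} (μ : Measure (HeightFunction d)) : Prop :=
  ∀ (R : Finset (Vertex d)) (A : Set (HeightFunction d)), MeasurableSet A →
    μ A = ∫⁻ f, gibbsKernel R A f ∂μ

def IsShiftInvariant {d : ℕ} (μ : Measure (HeightFunction d)) : Prop :=
  ∀ (x : Vertex d) (A : Set (HeightFunction d)), MeasurableSet A → μ (shift x '' A) = μ A

/-- `μ` has slope `s`: `s(x) = μ(f(x) - f(0))` for all `x`. -/
def HasSlope {d : ℕ} (μ : Measure (HeightFunction d)) (s : Slope d) : Prop :=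
  ∀ x : Vertex d, s (embed d x) = ∫ f, ((f x - f 0 : ℤ) : ℝ) ∂μ

/-- Shift-invariant gradient Gibbs measures of slope `s` with Azuma–Hoeffding concentration. -/
structure IsConcentratedGibbs {d : ℕ} (μ : Measure (HeightFunction d)) (s : Slope d) : Prop where
  isProb : IsProbabilityMeasure μ
  shiftInvariant : IsShiftInvariant μ
  gibbs : IsGradientGibbs μ
  slope : HasSlope μ s
  variance_le : ∀ x y : Vertex d,
    ProbabilityTheory.variance (fun f : HeightFunction d => ((f y - f x : ℤ) : ℝ)) μ
      ≤ ((d : ℝ) + 1) ^ 2 * (latticeGraph d).dist x y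
  upper_tail : ∀ x y : Vertex d, 0 < (latticeGraph d).dist x y → ∀ a : ℝ, 0 ≤ a →
    μ.real {f | ((d : ℝ) + 1) * a ≤ ((f y - f x : ℤ) : ℝ) - s (embed d (y - x))}
      ≤ Real.exp (-(a ^ 2 / (2 * (latticeGraph d).dist x y)))
  lower_tail : ∀ x y : Vertex d, 0 < (latticeGraph d).dist x y → ∀ a : ℝ, a ≤ 0 →
    μ.real {f | ((f y - f x : ℤ) : ℝ) - s (embed d (y - x)) ≤ ((d : ℝ) + 1) * a}
      ≤ Real.exp (-(a ^ 2 / (2 * (latticeGraph d).dist x y)))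

/-! ### Specific entropy -/

/-- The differences map `D_R f (x, y) = f(y) - f(x)`, for `x, y ∈ R`. -/
def diffMap {d : ℕ} (R : Finset (Vertex d)) (f : HeightFunction d) : R → R → ℤ :=
  fun x y => f y - f x

/-- The entropy `ℋ_R(μ) = ∑ μ(D_R f = z) log μ(D_R f = z)` over the (finite) image of `D_R`. -/
def entropyIn {d : ℕ} (R : Finset (Vertex d)) (μ : Measure (HeightFunction d)) : ℝ :=
  ∑ᶠ z ∈ Set.range (diffMap R),
    μ.real {f | diffMap R f = z} * Real.log (μ.real {f | diffMap R f = z})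

open Classical in
/-- The specific entropy `ℋ(μ)`: the limit of `|Πₙ|⁻¹ ℋ_{Πₙ}(μ)` if it exists, and the limit
inferior otherwise. -/
def specificEntropy {d : ℕ} (μ : Measure (HeightFunction d)) : ℝ :=
  if ∃ l, Tendsto (fun n : ℕ => 1 / ((box d n).card : ℝ) * entropyIn (box d n) μ) atTop (𝓝 l)
  then limUnder atTop fun n : ℕ => 1 / ((box d n).card : ℝ) * entropyIn (box d n) μ
  else liminf (fun n : ℕ => 1 / ((box d n).card : ℝ) * entropyIn (box d n) μ) atTop

end Stepped

end

/-!
Let `Tₙ = ∫ log |Ω(Πₙ, f)| dμ(f)`. By the DLR equations the entropy of `μ` in a box is the entropy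
of its boundary layer minus the mean logarithm of the number of modifications inside; a layer of
codimension one carries entropy `o(nᵈ)`, so `ℋ(μ) = -lim Tₙ / |Πₙ|`. The limit exists because
modifications of `f` in disjoint boxes can be made independently, which together with
shift-invariance makes `Tₙ` superadditive over tilings.

If `s(𝐠ᵢ) < 1` for all `i`, there is slack: a height function that stays within `o(n)` of `s`
can be glued to `⌊s⌋`, in either order, across an annulus of relative width as small as desired.
Concentration makes `μ`-most height functions of this kind, so `log |Ω(Πₙ, ⌊s⌋)|` is sandwiched
between `T` at slightly smaller and slightly larger boxes. If `s(𝐠ᵢ) = 1` for some `i`, then all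
steps of `⌊s⌋`, and of `μ`-almost every `f`, in the direction `𝐠ᵢ` are `+1`. Such height functions
admit no finite modification, and both sides vanish.
-/

noncomputable section

namespace Stepped

/-! ### Growth rates along boxes -/

section GrowthRates

variable {d : ℕ} {u v : ℕ → ℝ} {t : ℝ}

lemma tendsto_natFloor_mul_div {a : ℝ} (ha : 0 ≤ a) :
    Tendsto (fun m : ℕ => (⌊a * m⌋₊ : ℝ) / m) atTop (𝓝 a) :=
  (tendsto_nat_floor_mul_div_atTop ha).comp tendsto_natCast_atTop_atTop

lemma tendsto_natFloor_mul_atTop {a : ℝ} (ha : 0 < a) :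
    Tendsto (fun m : ℕ => ⌊a * m⌋₊) atTop atTop :=
  tendsto_nat_floor_atTop.comp (tendsto_natCast_atTop_atTop.const_mul_atTop ha)

lemma tendsto_comp_natFloor_mul (hu : Tendsto (fun n : ℕ => u n / (2 * n) ^ d) atTop (𝓝 t))
    {θ : ℝ} (hθ : 0 < θ) :
    Tendsto (fun n : ℕ => u ⌊θ * n⌋₊ / (2 * n) ^ d) atTop (𝓝 (θ ^ d * t)) := by
  have hfloor := tendsto_natFloor_mul_atTop hθ
  refine (((tendsto_natFloor_mul_div hθ.le).pow d).mul (hu.comp hfloor)).congr' ?_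
  filter_upwards [eventually_gt_atTop 0, hfloor.eventually_gt_atTop 0] with n hn hm
  have : (n : ℝ) ≠ 0 := Nat.cast_ne_zero.mpr hn.ne'
  have : (⌊θ * n⌋₊ : ℝ) ≠ 0 := Nat.cast_ne_zero.mpr hm.ne'
  simp only [Function.comp_apply]
  rw [← mul_div_assoc, div_pow, mul_pow, mul_pow]
  field_simp

lemma tendsto_natFloor_mul_pow_div {b : ℝ} (hb : 0 < b) (d : ℕ) (c : ℝ) :
    Tendsto (fun m : ℕ => (⌊2 / b * m⌋₊ : ℝ) ^ d * c / (2 * m) ^ d) atTop (𝓝 (c / b ^ d)) := by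
  have h := ((tendsto_natFloor_mul_div (a := 2 / b) (by positivity)).pow d).mul_const (c / 2 ^ d)
  have hlim : (2 / b) ^ d * (c / 2 ^ d) = c / b ^ d := by
    rw [div_pow]
    field_simp
  rw [hlim] at h
  refine h.congr fun m => ?_
  rw [div_pow, mul_pow, div_mul_div_comm, mul_comm (2 ^ d)]

lemma tendsto_two_mul_add_one_div_pow (d : ℕ) :
    Tendsto (fun m : ℕ => ((2 * m + 1 : ℝ) / (2 * m)) ^ d) atTop (𝓝 1) := by
  have h := ((tendsto_one_div_atTop_nhds_zero_nat (𝕜 := ℝ)).const_mul (1 / 2)).const_add 1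
  rw [mul_zero, add_zero] at h
  have hpow := h.pow d
  rw [one_pow] at hpow
  refine hpow.congr' ?_
  filter_upwards [eventually_gt_atTop 0] with m hm
  congr 1
  field_simp

/-- The multidimensional Fekete lemma: `k` to the power `d` is the number of disjoint translates of
a box of side `2n + 1` that are placed in a box of side `2m`. -/
lemma tendsto_div_pow_iSup (hbdd : BddAbove (Set.range fun n : ℕ => u n / (2 * n + 1) ^ d))
    (hsup : ∀ k n m : ℕ, k * (2 * n + 1) ≤ 2 * m → (k : ℝ) ^ d * u n ≤ u m) :
    Tendsto (fun n : ℕ => u n / (2 * n) ^ d) atTop (𝓝 (⨆ n : ℕ, u n / (2 * n + 1) ^ d)) := by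
  refine tendsto_order.mpr ⟨fun a ha => ?_, fun a ha => ?_⟩
  · obtain ⟨n, hn⟩ := exists_lt_of_lt_ciSup ha
    have hb : (0 : ℝ) < 2 * n + 1 := by positivity
    filter_upwards [(tendsto_natFloor_mul_pow_div hb d (u n)).eventually_const_lt hn] with m hm
    refine hm.trans_le (div_le_div_of_nonneg_right (hsup _ n m ?_) (by positivity))
    have hfloor : (⌊2 / (2 * n + 1 : ℝ) * m⌋₊ : ℝ) ≤ 2 * m / (2 * n + 1) :=
      (Nat.floor_le (by positivity)).trans_eq (div_mul_eq_mul_div _ _ _)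
    exact_mod_cast (le_div_iff₀ hb).mp hfloor
  · have hlim := (tendsto_two_mul_add_one_div_pow d).const_mul (⨆ n : ℕ, u n / (2 * n + 1) ^ d)
    rw [mul_one] at hlim
    filter_upwards [hlim.eventually_lt_const ha] with m hm
    refine lt_of_le_of_lt ?_ hm
    rw [div_pow, ← mul_div_assoc]
    gcongr
    exact (div_le_iff₀ (by positivity)).mp (le_ciSup hbdd m)

lemma eventually_lt_of_natFloor_le (hu : Tendsto (fun n : ℕ => u n / (2 * n) ^ d) atTop (𝓝 t))
    (h : ∀ θ : ℝ, 0 < θ → θ < 1 → ∃ e : ℕ → ℝ, Tendsto e atTop (𝓝 0) ∧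
      ∀ᶠ n : ℕ in atTop, u ⌊θ * n⌋₊ / (2 * n) ^ d ≤ v n / (2 * n) ^ d + e n)
    {a : ℝ} (ha : a < t) : ∀ᶠ n : ℕ in atTop, a < v n / (2 * n) ^ d := by
  have hcont : Tendsto (fun θ : ℝ => θ ^ d * t) (𝓝[<] 1) (𝓝 t) := by
    have : ContinuousAt (fun θ : ℝ => θ ^ d * t) 1 := by fun_prop
    simpa using this.tendsto.mono_left nhdsWithin_le_nhds
  obtain ⟨θ, hat, hθ0, hθ1⟩ := ((hcont.eventually_const_lt ha).and
    (Ioo_mem_nhdsLT zero_lt_one)).exists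
  obtain ⟨e, he, hle⟩ := h θ hθ0 hθ1
  have hlim := (tendsto_comp_natFloor_mul hu hθ0).sub he
  rw [sub_zero] at hlim
  filter_upwards [hlim.eventually_const_lt hat, hle] with n h1 h2
  linarith

lemma eventually_gt_of_le_natFloor (hu : Tendsto (fun n : ℕ => u n / (2 * n) ^ d) atTop (𝓝 t))
    (h : ∀ κ : ℝ, 1 < κ → ∃ e : ℕ → ℝ, Tendsto e atTop (𝓝 0) ∧
      ∀ᶠ n : ℕ in atTop, v n / (2 * n) ^ d ≤ u ⌊κ * n⌋₊ / (2 * n) ^ d + e n)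
    {a : ℝ} (ha : t < a) : ∀ᶠ n : ℕ in atTop, v n / (2 * n) ^ d < a := by
  have hcont : Tendsto (fun κ : ℝ => κ ^ d * t) (𝓝[>] 1) (𝓝 t) := by
    have : ContinuousAt (fun κ : ℝ => κ ^ d * t) 1 := by fun_prop
    simpa using this.tendsto.mono_left nhdsWithin_le_nhds
  obtain ⟨κ, hta, hκ⟩ := ((hcont.eventually_lt_const ha).and self_mem_nhdsWithin).exists
  obtain ⟨e, he, hle⟩ := h κ hκ
  have hlim := (tendsto_comp_natFloor_mul hu (zero_lt_one.trans hκ)).add he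
  rw [add_zero] at hlim
  filter_upwards [hlim.eventually_lt_const hta, hle] with n h1 h2
  linarith

lemma tendsto_of_natFloor_bounds (hu : Tendsto (fun n : ℕ => u n / (2 * n) ^ d) atTop (𝓝 t))
    (hlower : ∀ θ : ℝ, 0 < θ → θ < 1 → ∃ e : ℕ → ℝ, Tendsto e atTop (𝓝 0) ∧
      ∀ᶠ n : ℕ in atTop, u ⌊θ * n⌋₊ / (2 * n) ^ d ≤ v n / (2 * n) ^ d + e n)
    (hupper : ∀ κ : ℝ, 1 < κ → ∃ e : ℕ → ℝ, Tendsto e atTop (𝓝 0) ∧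
      ∀ᶠ n : ℕ in atTop, v n / (2 * n) ^ d ≤ u ⌊κ * n⌋₊ / (2 * n) ^ d + e n) :
    Tendsto (fun n : ℕ => v n / (2 * n) ^ d) atTop (𝓝 t) :=
  tendsto_order.mpr ⟨fun _ => eventually_lt_of_natFloor_le hu hlower,
    fun _ => eventually_gt_of_le_natFloor hu hupper⟩

lemma tendsto_div_succ_pow (hu : Tendsto (fun n : ℕ => u n / (2 * n) ^ d) atTop (𝓝 t)) :
    Tendsto (fun n : ℕ => u n / (2 * (n + 1)) ^ d) atTop (𝓝 t) := by
  have hlim := hu.mul ((tendsto_natCast_div_add_atTop (1 : ℝ)).pow d)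
  rw [one_pow, mul_one] at hlim
  refine hlim.congr' ?_
  filter_upwards [eventually_gt_atTop 0] with n hn
  rw [div_pow, mul_pow, mul_pow]
  field_simp

lemma tendsto_log_mul_add_one_div {c : ℝ} (hc : 0 ≤ c) :
    Tendsto (fun n : ℕ => Real.log (c * n + 1) / n) atTop (𝓝 0) := by
  have h := (tendsto_inv_atTop_zero.const_mul (Real.log (c + 1))).add
    Real.isLittleO_log_id_atTop.tendsto_div_nhds_zero
  rw [mul_zero, add_zero] at h
  refine squeeze_zero' (Eventually.of_forall fun n => ?_) ?_
    (h.comp tendsto_natCast_atTop_atTop)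
  · exact div_nonneg (Real.log_nonneg (le_add_of_nonneg_left (by positivity))) n.cast_nonneg
  · filter_upwards [eventually_ge_atTop 1] with n hn
    have hn' : (1 : ℝ) ≤ n := Nat.one_le_cast.mpr hn
    simp only [Function.comp_apply, id_eq]
    rw [← div_eq_mul_inv, ← add_div, ← Real.log_mul (by positivity) (by positivity)]
    gcongr
    linarith

lemma eventually_le_mul_natCast {c : ℝ} (hc : 0 < c) (C : ℝ) : ∀ᶠ n : ℕ in atTop, C ≤ c * n :=
  (tendsto_natCast_atTop_atTop.const_mul_atTop hc).eventually_ge_atTop C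

end GrowthRates

/-! ### Finite-valued random variables -/

section FiniteRange

/-- Jensen's inequality for `x ↦ x log x`. -/
lemma neg_log_card_le_sum_mul_log {ι : Type*} {S : Finset ι} {p : ι → ℝ}
    (hp : ∀ z ∈ S, 0 ≤ p z) (hsum : ∑ z ∈ S, p z = 1) :
    -Real.log S.card ≤ ∑ z ∈ S, p z * Real.log (p z) := by
  have hcard : (0 : ℝ) < S.card := by
    rw [Nat.cast_pos, Finset.card_pos, Finset.nonempty_iff_ne_empty]
    rintro rfl
    simp at hsum
  have hJensen := Real.convexOn_mul_log.map_sum_le (t := S) (w := fun _ => (S.card : ℝ)⁻¹)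
    (fun _ _ => by positivity) (by simp [hcard.ne']) hp
  simp only [smul_eq_mul, ← Finset.mul_sum, hsum, mul_one] at hJensen
  rw [Real.log_inv] at hJensen
  exact le_of_mul_le_mul_left hJensen (inv_pos.mpr hcard)

variable {Ω β : Type*} [MeasurableSpace Ω] [MeasurableSpace β] [DiscreteMeasurableSpace β]
  {μ : Measure Ω} {X : Ω → β}

lemma measureReal_preimage_eq_map (hX : Measurable X) (z : β) :
    μ.real (X ⁻¹' {z}) = (μ.map X).real {z} :=
  (map_measureReal_apply hX (MeasurableSet.of_discrete)).symm

lemma integral_comp_eq_sum [IsFiniteMeasure μ] (hX : Measurable X) {S : Finset β}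
    (hS : ∀ ω, X ω ∈ S) (φ : β → ℝ) :
    ∫ ω, φ (X ω) ∂μ = ∑ z ∈ S, μ.real (X ⁻¹' {z}) * φ z := by
  have hSae : ∀ᵐ z ∂μ.map X, z ∈ (S : Set β) :=
    (ae_map_iff hX.aemeasurable MeasurableSet.of_discrete).mpr (Eventually.of_forall hS)
  rw [← integral_map hX.aemeasurable (Measurable.of_discrete).aestronglyMeasurable,
    ← Measure.restrict_eq_self_of_ae_mem hSae, setIntegral_finset _ ?_]
  · simp only [measureReal_preimage_eq_map hX, smul_eq_mul]
  · exact IntegrableOn.of_finite S.finite_toSet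

lemma sum_measureReal_preimage_eq_one [IsProbabilityMeasure μ] (hX : Measurable X) {S : Finset β}
    (hS : ∀ ω, X ω ∈ S) : ∑ z ∈ S, μ.real (X ⁻¹' {z}) = 1 := by
  simpa using (integral_comp_eq_sum (μ := μ) hX hS fun _ => 1).symm

lemma ae_measureReal_preimage_pos [IsFiniteMeasure μ] [Countable β] (hX : Measurable X) :
    ∀ᵐ ω ∂μ, 0 < μ.real (X ⁻¹' {X ω}) := by
  have h : ∀ᵐ z ∂μ.map X, 0 < μ.real (X ⁻¹' {z}) := by
    rw [ae_iff_of_countable]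
    intro z hz
    rw [measureReal_preimage_eq_map hX]
    exact ENNReal.toReal_pos hz (measure_ne_top _ _)
  exact ae_of_ae_map hX.aemeasurable h

end FiniteRange

lemma integral_le_integral_add_measureReal_mul {Ω : Type*} [MeasurableSpace Ω] {μ : Measure Ω}
    [IsFiniteMeasure μ] {φ ψ : Ω → ℝ} {D : Set Ω} {C : ℝ} (hD : MeasurableSet D)
    (hφ : Integrable φ μ) (hψ : Integrable ψ μ) (hle : ∀ ω ∉ D, φ ω ≤ ψ ω)
    (hφC : ∀ ω ∈ D, φ ω ≤ C) (hψ0 : ∀ ω ∈ D, 0 ≤ ψ ω) :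
    ∫ ω, φ ω ∂μ ≤ ∫ ω, ψ ω ∂μ + μ.real D * C := by
  have hind : Integrable (D.indicator fun _ => C) μ := (integrable_const C).indicator hD
  calc ∫ ω, φ ω ∂μ ≤ ∫ ω, (ψ ω + D.indicator (fun _ => C) ω) ∂μ := by
        refine integral_mono hφ (hψ.add hind) fun ω => ?_
        by_cases hω : ω ∈ D
        · simpa [hω] using le_add_of_nonneg_of_le (hψ0 ω hω) (hφC ω hω)
        · simpa [hω] using hle ω hω
    _ = ∫ ω, ψ ω ∂μ + μ.real D * C := by
        rw [integral_add hψ hind, integral_indicator_const C hD, smul_eq_mul]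

variable {d : ℕ}

/-! ### Coordinates and boxes -/

/-- The coordinates of a vertex in the basis `gen 0, …, gen (d - 1)`; they identify `X^d`
with `ℤ^d`. -/
def coord (d : ℕ) : Vertex d →+ (Fin d → ℤ) :=
  QuotientAddGroup.lift _
    (AddMonoidHom.mk' (fun (x : Fin (d + 1) → ℤ) (i : Fin d) => x i.castSucc - x (Fin.last d))
      (fun x y => by ext i; simp only [Pi.add_apply]; ring))
    (by
      refine AddSubgroup.zmultiples_le_of_mem ?_
      rw [AddMonoidHom.mem_ker]
      ext i
      simp)

lemma coord_cls (x : Fin (d + 1) → ℤ) (i : Fin d) :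
    coord d (cls x) i = x i.castSucc - x (Fin.last d) := rfl

lemma coord_gen_castSucc (i : Fin d) : coord d (gen i.castSucc) = Pi.single i 1 := by
  ext j
  rw [gen, coord_cls, Pi.single_eq_of_ne (Fin.castSucc_ne_last i).symm, sub_zero]
  simp [Pi.single_apply]

lemma coord_gen_last : coord d (gen (Fin.last d)) = -1 := by
  ext j
  rw [gen, coord_cls]
  simp

lemma coord_injective : Function.Injective (coord d) := by
  rw [injective_iff_map_eq_zero]
  intro x hx
  induction x using QuotientAddGroup.induction_on with
  | H v =>
    rw [QuotientAddGroup.eq_zero_iff, AddSubgroup.mem_zmultiples_iff]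
    refine ⟨v (Fin.last d), ?_⟩
    ext i
    induction i using Fin.lastCases with
    | last => simp
    | cast i => simpa [coord_cls, sub_eq_zero, eq_comm] using congrFun hx i

/-- The vertex with given coordinates. -/
def ofCoord (a : Fin d → ℤ) : Vertex d := ∑ i, a i • gen i.castSucc

@[simp] lemma coord_ofCoord (a : Fin d → ℤ) : coord d (ofCoord a) = a := by
  ext j
  simp [ofCoord, coord_gen_castSucc, Finset.sum_apply, Pi.single_apply]

@[simp] lemma ofCoord_coord (x : Vertex d) : ofCoord (coord d x) = x :=
  coord_injective (coord_ofCoord _)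

lemma ofCoord_injective : Function.Injective (ofCoord (d := d)) :=
  Function.LeftInverse.injective coord_ofCoord

instance : Countable (Vertex d) := coord_injective.countable

lemma mem_box {n : ℕ} {x : Vertex d} :
    x ∈ box d n ↔ ∀ i, -(n : ℤ) ≤ coord d x i ∧ coord d x i < n := by
  classical
  simp only [box, Finset.mem_image, Fintype.mem_piFinset, Finset.mem_Ico]
  constructor
  · rintro ⟨a, ha, rfl⟩ i
    change -(n : ℤ) ≤ coord d (ofCoord a) i ∧ coord d (ofCoord a) i < n
    rw [coord_ofCoord]
    exact ha i
  · exact fun h => ⟨coord d x, h, ofCoord_coord x⟩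

lemma card_box (n : ℕ) : (box d n).card = (2 * n) ^ d := by
  classical
  rw [box, Finset.card_image_of_injective _ (show Function.Injective
    fun a : Fin d → ℤ => ∑ i, a i • gen i.castSucc from ofCoord_injective),
    Fintype.card_piFinset]
  simp only [Int.card_Ico, Finset.prod_const, Finset.card_univ, Fintype.card_fin]
  congr 1
  omega

lemma coord_gen_mem_Icc (i : Fin (d + 1)) (j : Fin d) :
    -1 ≤ coord d (gen i) j ∧ coord d (gen i) j ≤ 1 := by
  induction i using Fin.lastCases with
  | last => rw [coord_gen_last]; simp
  | cast i =>
    rw [coord_gen_castSucc, Pi.single_apply]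
    split_ifs <;> simp

lemma add_gen_mem_box {n : ℕ} {x : Vertex d} (hx : x ∈ box d n) (i : Fin (d + 1)) :
    x + gen i ∈ box d (n + 1) := by
  rw [mem_box] at *
  intro j
  have h1 := hx j
  have h2 := coord_gen_mem_Icc i j
  rw [map_add, Pi.add_apply]
  push_cast
  omega

lemma mem_box_of_add_gen {n : ℕ} {x : Vertex d} {i : Fin (d + 1)} (hx : x + gen i ∈ box d n) :
    x ∈ box d (n + 1) := by
  rw [mem_box] at *
  intro j
  have h1 := hx j
  have h2 := coord_gen_mem_Icc i j
  rw [map_add, Pi.add_apply] at h1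
  push_cast
  omega

lemma box_mono {m n : ℕ} (h : m ≤ n) : box d m ⊆ box d n := by
  intro x hx
  rw [mem_box] at *
  intro i
  have := hx i
  omega

lemma zero_mem_box {n : ℕ} (hn : 0 < n) : 0 ∈ box d n := by
  rw [mem_box]
  intro i
  simpa using hn

lemma norm_coord_gen_le_one (i : Fin (d + 1)) : ‖coord d (gen i)‖ ≤ 1 := by
  rw [pi_norm_le_iff_of_nonneg zero_le_one]
  intro j
  rw [Int.norm_eq_abs, ← Int.cast_abs]
  exact_mod_cast abs_le.mpr (coord_gen_mem_Icc i j)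

lemma norm_coord_le_of_mem_box {n : ℕ} {x : Vertex d} (hx : x ∈ box d n) :
    ‖coord d x‖ ≤ n := by
  rw [pi_norm_le_iff_of_nonneg n.cast_nonneg]
  intro j
  have h := mem_box.mp hx j
  rw [Int.norm_eq_abs, ← Int.cast_abs]
  exact_mod_cast abs_le.mpr ⟨h.1, h.2.le⟩

lemma le_norm_coord_of_notMem_box {n : ℕ} {x : Vertex d} (hx : x ∉ box d n) :
    (n : ℝ) ≤ ‖coord d x‖ := by
  rw [mem_box] at hx
  push Not at hx
  obtain ⟨i, hi⟩ := hx
  refine le_trans ?_ (norm_le_pi_norm (coord d x) i)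
  rw [Int.norm_eq_abs, ← Int.cast_abs]
  have : (n : ℤ) ≤ |coord d x i| := le_abs'.mpr <| (lt_or_ge _ _).imp le_of_lt (hi ·)
  exact_mod_cast this

lemma abs_norm_coord_add_gen_sub_le (x : Vertex d) (i : Fin (d + 1)) :
    |‖coord d (x + gen i)‖ - ‖coord d x‖| ≤ 1 := by
  refine (abs_norm_sub_norm_le _ _).trans ?_
  rw [map_add, add_sub_cancel_left]
  exact norm_coord_gen_le_one i

lemma gen_ne_zero [NeZero d] (i : Fin (d + 1)) : (gen i : Vertex d) ≠ 0 := by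
  intro h
  have h0 := congrArg (coord d) h
  rw [map_zero] at h0
  induction i using Fin.lastCases with
  | last => simpa [coord_gen_last] using congrFun h0 0
  | cast i => simpa [coord_gen_castSucc] using congrFun h0 i

lemma exists_add_nsmul_notMem {v : Vertex d} (hv : v ≠ 0) (R : Finset (Vertex d))
    (x : Vertex d) : ∃ k : ℕ, x + k • v ∉ R := by
  by_contra! h
  refine Set.infinite_range_of_injective (f := fun k : ℕ => x + k • v) (fun k l hkl => ?_)
    (R.finite_toSet.subset (Set.range_subset_iff.mpr h))
  have hcoord : (k : ℤ) • coord d v = (l : ℤ) • coord d v := by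
    simpa using congrArg (coord d) (add_left_cancel hkl)
  exact_mod_cast smul_left_injective ℤ ((map_ne_zero_iff _ coord_injective).mpr hv) hcoord

/-! ### The graph distance -/

lemma latticeGraph_adj_add_gen {i : Fin (d + 1)} (hi : (gen i : Vertex d) ≠ 0) (x : Vertex d) :
    (latticeGraph d).Adj x (x + gen i) := by
  rw [latticeGraph, SimpleGraph.fromRel_adj]
  exact ⟨by simpa using hi, Or.inl ⟨i, rfl⟩⟩

lemma reachable_add_gen (x : Vertex d) (i : Fin (d + 1)) :
    (latticeGraph d).Reachable x (x + gen i) := by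
  by_cases hi : (gen i : Vertex d) = 0
  · simp [hi]
  · exact (latticeGraph_adj_add_gen hi x).reachable

lemma dist_add_gen_le_one (x : Vertex d) (i : Fin (d + 1)) :
    (latticeGraph d).dist x (x + gen i) ≤ 1 := by
  by_cases hi : (gen i : Vertex d) = 0
  · simp [hi]
  · exact (SimpleGraph.dist_eq_one_iff_adj.mpr (latticeGraph_adj_add_gen hi x)).le

lemma latticeGraph_connected (d : ℕ) : (latticeGraph d).Connected := by
  let K : AddSubgroup (Vertex d) :=
    { carrier := {v | ∀ x, (latticeGraph d).Reachable x (x + v)}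
      zero_mem' := fun x => by simp
      add_mem' := fun {v w} hv hw x => by
        rw [← add_assoc]
        exact (hv x).trans (hw (x + v))
      neg_mem' := fun {v} hv x => by simpa using (hv (x + -v)).symm }
  have hK : ∀ v, v ∈ K := fun v => by
    rw [← ofCoord_coord v, ofCoord]
    exact sum_mem fun i _ => K.zsmul_mem (fun x => reachable_add_gen x i.castSucc) _
  exact (SimpleGraph.connected_iff _).mpr ⟨fun x y => by simpa using hK (y - x) x, inferInstance⟩

lemma dist_add_nsmul_gen_le (x : Vertex d) (i : Fin (d + 1)) (n : ℕ) :
    (latticeGraph d).dist x (x + n • gen i) ≤ n := by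
  induction n with
  | zero => simp
  | succ n ih =>
    rw [succ_nsmul, ← add_assoc]
    exact (latticeGraph_connected d).dist_triangle.trans
      (add_le_add ih (dist_add_gen_le_one _ i))

lemma dist_add_zsmul_gen_le (x : Vertex d) (i : Fin (d + 1)) (k : ℤ) :
    (latticeGraph d).dist x (x + k • gen i) ≤ k.natAbs := by
  obtain ⟨n, rfl | rfl⟩ := k.eq_nat_or_neg
  · simpa using dist_add_nsmul_gen_le x i n
  · simpa [SimpleGraph.dist_comm] using dist_add_nsmul_gen_le (x + -(n : ℤ) • gen i) i n

lemma dist_zero_le_sum_natAbs_coord (x : Vertex d) :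
    (latticeGraph d).dist 0 x ≤ ∑ i, (coord d x i).natAbs := by
  classical
  have h (A : Finset (Fin d)) : (latticeGraph d).dist 0 (∑ i ∈ A, coord d x i • gen i.castSucc)
      ≤ ∑ i ∈ A, (coord d x i).natAbs := by
    induction A using Finset.induction_on with
    | empty => simp
    | insert j A hj ih =>
      rw [Finset.sum_insert hj, Finset.sum_insert hj, add_comm (_ • _), add_comm (Int.natAbs _)]
      exact (latticeGraph_connected d).dist_triangle.trans
        (add_le_add ih (dist_add_zsmul_gen_le _ _ _))
  simpa only [← ofCoord.eq_1, ofCoord_coord] using h Finset.univ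

lemma dist_zero_le_of_mem_box {n : ℕ} {x : Vertex d} (hx : x ∈ box d n) :
    (latticeGraph d).dist 0 x ≤ d * n :=
  calc (latticeGraph d).dist 0 x ≤ ∑ i, (coord d x i).natAbs := dist_zero_le_sum_natAbs_coord x
    _ ≤ ∑ _i : Fin d, n := Finset.sum_le_sum fun i _ => by have := mem_box.mp hx i; omega
    _ = d * n := by simp

/-- Functions with the gradient of a height function, without the normalisation at the origin. -/
def HasSteps (f : Vertex d → ℤ) : Prop :=
  ∀ x i, f (x + gen i) - f x = 1 ∨ f (x + gen i) - f x = -(d : ℤ)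

lemma HasSteps.abs_sub_le_of_adj {f : Vertex d → ℤ} (hf : HasSteps f) {x y : Vertex d}
    (h : (latticeGraph d).Adj x y) : |f y - f x| ≤ d := by
  rw [latticeGraph, SimpleGraph.fromRel_adj] at h
  have hd : d ≠ 0 := by
    rintro rfl
    exact h.1 (coord_injective (Subsingleton.elim _ _))
  rw [abs_le]
  rcases h.2 with ⟨i, rfl⟩ | ⟨i, rfl⟩
  · rcases hf x i with h | h <;> omega
  · rcases hf y i with h | h <;> omega

lemma HasSteps.abs_sub_le_mul_dist {f : Vertex d → ℤ} (hf : HasSteps f) (x y : Vertex d) :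
    |f y - f x| ≤ d * (latticeGraph d).dist x y := by
  obtain ⟨w, hw⟩ := (latticeGraph_connected d).exists_walk_length_eq_dist x y
  rw [← hw]
  clear hw
  induction w with
  | nil => simp
  | @cons u v z h p ih =>
    rw [SimpleGraph.Walk.length_cons]
    push_cast
    linarith [abs_sub_le (f z) (f v) (f u), hf.abs_sub_le_of_adj h]

/-! ### Operations on height functions -/

namespace HeightFunction

lemma hasSteps (f : HeightFunction d) : HasSteps f := f.grad

lemma abs_sub_zero_le (f : HeightFunction d) {n : ℕ} {x : Vertex d} (hx : x ∈ box d n) :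
    |f x - f 0| ≤ d * (d * n : ℕ) := by
  refine (f.hasSteps.abs_sub_le_mul_dist 0 x).trans ?_
  gcongr
  exact dist_zero_le_of_mem_box hx

/-- Addition of a multiple of `d + 1`. -/
def addConst (f : HeightFunction d) (c : ℤ) (hc : ((d : ℤ) + 1) ∣ c) : HeightFunction d where
  toFun x := f x + c
  dvd_zero := dvd_add f.dvd_zero hc
  grad x i := by simpa using f.grad x i

/-- The height function that vanishes at the origin and has the gradient of `f`. -/
def normalize (f : HeightFunction d) : HeightFunction d :=
  f.addConst (-f 0) ((dvd_neg).mpr f.dvd_zero)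

lemma normalize_apply (f : HeightFunction d) (x : Vertex d) : f.normalize x = f x - f 0 := rfl

lemma dvd_sub (f g : HeightFunction d) (x : Vertex d) : ((d : ℤ) + 1) ∣ f x - g x := by
  have h : ((f x - g x : ℤ) : ZMod (d + 1)) = 0 := by
    push_cast
    rw [f.cast_eq_residue, g.cast_eq_residue, sub_self]
  exact_mod_cast (ZMod.intCast_zmod_eq_zero_iff_dvd _ _).mp h

open Classical in
/-- The height function that equals `g` on `R` and `f` elsewhere; `g` and `f` have to agree at the
outer end of each edge that leaves `R` and at the initial end of each edge that enters it. -/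
def glue (R : Set (Vertex d)) (g f : HeightFunction d)
    (hout : ∀ x ∈ R, ∀ i, x + gen i ∉ R → g (x + gen i) = f (x + gen i))
    (hin : ∀ x ∉ R, ∀ i, x + gen i ∈ R → g x = f x) : HeightFunction d where
  toFun x := if x ∈ R then g x else f x
  dvd_zero := by
    split_ifs
    exacts [g.dvd_zero, f.dvd_zero]
  grad x i := by
    by_cases hx : x ∈ R <;> by_cases hy : x + gen i ∈ R
    · simpa [hx, hy] using g.grad x i
    · simpa [hx, hy, ← hout x hx i hy] using g.grad x i
    · simpa [hx, hy, ← hin x hx i hy] using g.grad x i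
    · simpa [hx, hy] using f.grad x i

/-- Differences of height functions are multiples of `d + 1` and change by at most `d + 1` along
an edge, so they cannot change sign strictly. -/
lemma le_and_le_or (f g : HeightFunction d) (x : Vertex d) (i : Fin (d + 1)) :
    (f x ≤ g x ∧ f (x + gen i) ≤ g (x + gen i)) ∨
      (g x ≤ f x ∧ g (x + gen i) ≤ f (x + gen i)) := by
  obtain ⟨t, ht⟩ := f.dvd_sub g x
  rcases lt_trichotomy t 0 with h | rfl | h
  · left
    have : ((d : ℤ) + 1) * t ≤ -(d + 1) := by nlinarith
    rcases f.grad x i with a | a <;> rcases g.grad x i with b | b <;> constructor <;> linarith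
  · exact (le_total (f (x + gen i)) (g (x + gen i))).imp (⟨by linarith, ·⟩) (⟨by linarith, ·⟩)
  · right
    have : (d : ℤ) + 1 ≤ ((d : ℤ) + 1) * t := by nlinarith
    rcases f.grad x i with a | a <;> rcases g.grad x i with b | b <;> constructor <;> linarith

instance : Max (HeightFunction d) where
  max f g :=
    { toFun := fun x => max (f x) (g x)
      dvd_zero := by
        rcases max_choice (f 0) (g 0) with h | h <;> rw [h]
        exacts [f.dvd_zero, g.dvd_zero]
      grad := fun x i => by
        rcases f.le_and_le_or g x i with ⟨h, h'⟩ | ⟨h, h'⟩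
        · rw [max_eq_right h, max_eq_right h']; exact g.grad x i
        · rw [max_eq_left h, max_eq_left h']; exact f.grad x i }

instance : Min (HeightFunction d) where
  min f g :=
    { toFun := fun x => min (f x) (g x)
      dvd_zero := by
        rcases min_choice (f 0) (g 0) with h | h <;> rw [h]
        exacts [f.dvd_zero, g.dvd_zero]
      grad := fun x i => by
        rcases f.le_and_le_or g x i with ⟨h, h'⟩ | ⟨h, h'⟩
        · rw [min_eq_left h, min_eq_left h']; exact f.grad x i
        · rw [min_eq_right h, min_eq_right h']; exact g.grad x i }

lemma max_apply (f g : HeightFunction d) (x : Vertex d) : (max f g) x = max (f x) (g x) := rfl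

lemma min_apply (f g : HeightFunction d) (x : Vertex d) : (min f g) x = min (f x) (g x) := rfl

end HeightFunction

/-! ### Local modifications of height functions -/

/-- The differences `g - f` for `g ∈ Ω(R, f)`: the functions `δ` supported in `R` such that `f + δ`
has the steps of a height function. Neither `f` nor `f + δ` has to be normalised at the origin, so
that modifications can be translated and depend only on the gradient of `f`. -/
def modifications (R : Set (Vertex d)) (f : Vertex d → ℤ) : Set (Vertex d → ℤ) :=
  {δ | (∀ x ∉ R, δ x = 0) ∧ HasSteps (f + δ)}

/-- The number of modifications of `f` in `R`; it equals `|Ω(R, f)|` by `ncard_fixedBdry`. -/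
def numMod (R : Finset (Vertex d)) (f : Vertex d → ℤ) : ℕ :=
  (modifications (R : Set (Vertex d)) f).ncard

/-- Two sets of vertices are separated if no edge meets both of them. -/
def Separated (S T : Set (Vertex d)) : Prop :=
  ∀ x i, x ∈ S ∨ x + gen i ∈ S → x ∉ T ∧ x + gen i ∉ T

section Modifications

variable {R S T Q : Finset (Vertex d)} {f g : Vertex d → ℤ} {δ ε : Vertex d → ℤ}

lemma forall_of_forall_notMem {P : Vertex d → Prop} {v : Vertex d} (hv : v ≠ 0)
    (hR : ∀ x ∉ R, P x) (hstep : ∀ x, P (x + v) → P x) (x : Vertex d) : P x := by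
  obtain ⟨k, hk⟩ := exists_add_nsmul_notMem hv R x
  replace hk := hR _ hk
  induction k with
  | zero => simpa using hk
  | succ k ih => exact ih (hstep _ (by rwa [add_assoc, ← succ_nsmul]))

lemma zero_mem_modifications (R : Set (Vertex d)) (hf : HasSteps f) : 0 ∈ modifications R f :=
  ⟨fun _ _ => rfl, by rwa [add_zero]⟩

lemma modifications_mono {R Q : Set (Vertex d)} (h : R ⊆ Q) (f : Vertex d → ℤ) :
    modifications R f ⊆ modifications Q f :=
  fun _ hδ => ⟨fun x hx => hδ.1 x fun hxR => hx (h hxR), hδ.2⟩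

lemma dvd_of_mem_modifications [NeZero d] (hf : HasSteps f)
    (hδ : δ ∈ modifications (R : Set (Vertex d)) f) (x : Vertex d) : ((d : ℤ) + 1) ∣ δ x := by
  refine forall_of_forall_notMem (P := fun x => ((d : ℤ) + 1) ∣ δ x) (R := R) (gen_ne_zero 0)
    (fun y hy => ?_) (fun y hy => ?_) x
  · simp [hδ.1 y hy]
  · have hdiff : ((d : ℤ) + 1) ∣ δ (y + gen 0) - δ y := by
      have hfδ := hδ.2 y 0
      simp only [Pi.add_apply] at hfδ
      rcases hfδ with h | h <;> rcases hf y 0 with h' | h'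
      · exact ⟨0, by linarith⟩
      · exact ⟨1, by linarith⟩
      · exact ⟨-1, by linarith⟩
      · exact ⟨0, by linarith⟩
    exact (dvd_sub_right hy).mp hdiff

lemma ncard_fixedBdry [NeZero d] (R : Finset (Vertex d)) (f : HeightFunction d) :
    (fixedBdry (R : Set (Vertex d)) f).ncard = numMod R f := by
  refine Set.ncard_congr (fun g _ => (g : Vertex d → ℤ) - f) (fun g hg => ⟨?_, ?_⟩) ?_ ?_
  · exact fun x hx => by simp [hg x hx]
  · rw [add_sub_cancel]
    exact g.hasSteps
  · exact fun g g' _ _ h => HeightFunction.ext (sub_left_injective h)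
  · intro δ hδ
    refine ⟨⟨f + δ, dvd_add f.dvd_zero (dvd_of_mem_modifications f.hasSteps hδ 0), hδ.2⟩,
      fun x hx => by simp [hδ.1 x hx], add_sub_cancel_left _ _⟩

lemma injective_modification_steps [NeZero d] (R : Finset (Vertex d)) (f : Vertex d → ℤ)
    (i : Fin (d + 1)) :
    Function.Injective fun (δ : modifications (R : Set (Vertex d)) f) (x : R) =>
      decide ((f + δ.1) (x + gen i) - (f + δ.1) x = 1) := by
  intro δ ε h
  ext x
  refine forall_of_forall_notMem (P := fun x => δ.1 x = ε.1 x) (gen_ne_zero i) (R := R)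
    (fun y hy => ?_) (fun y hy => ?_) x
  · rw [δ.2.1 y hy, ε.2.1 y hy]
  · by_cases hyR : y ∈ R
    · have hiff := decide_eq_decide.mp (congrFun h ⟨y, hyR⟩)
      have hδ := δ.2.2 y i
      have hε := ε.2.2 y i
      simp only [Pi.add_apply] at hiff hδ hε
      omega
    · rw [δ.2.1 y hyR, ε.2.1 y hyR]

lemma finite_modifications [NeZero d] (R : Finset (Vertex d)) (f : Vertex d → ℤ) :
    (modifications (R : Set (Vertex d)) f).Finite :=
  Finite.of_injective _ (injective_modification_steps R f 0)

lemma numMod_le_two_pow [NeZero d] (R : Finset (Vertex d)) (f : Vertex d → ℤ) :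
    numMod R f ≤ 2 ^ R.card := by
  have h := Nat.card_le_card_of_injective _ (injective_modification_steps R f 0)
  rw [Nat.card_coe_set_eq] at h
  simpa [numMod] using h

lemma numMod_pos [NeZero d] (R : Finset (Vertex d)) (hf : HasSteps f) : 0 < numMod R f :=
  (Set.ncard_pos (finite_modifications R f)).mpr ⟨0, zero_mem_modifications _ hf⟩

lemma numMod_mono [NeZero d] (h : R ⊆ Q) (f : Vertex d → ℤ) : numMod R f ≤ numMod Q f :=
  Set.ncard_le_ncard (modifications_mono (Finset.coe_subset.mpr h) f) (finite_modifications Q f)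

lemma modifications_subset_of_sub_eq (hg : HasSteps g)
    (h : ∀ x i, x ∈ R ∨ x + gen i ∈ R → f (x + gen i) - f x = g (x + gen i) - g x) :
    modifications (R : Set (Vertex d)) f ⊆ modifications (R : Set (Vertex d)) g := by
  refine fun δ hδ => ⟨hδ.1, fun x i => ?_⟩
  simp only [Pi.add_apply]
  by_cases hx : x ∈ R ∨ x + gen i ∈ R
  · have hfδ := hδ.2 x i
    simp only [Pi.add_apply] at hfδ
    have := h x i hx
    omega
  · rw [not_or] at hx
    rw [hδ.1 x hx.1, hδ.1 _ hx.2]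
    simpa using hg x i

lemma numMod_congr (hf : HasSteps f) (hg : HasSteps g)
    (h : ∀ x i, x ∈ R ∨ x + gen i ∈ R → f (x + gen i) - f x = g (x + gen i) - g x) :
    numMod R f = numMod R g :=
  congrArg Set.ncard <| (modifications_subset_of_sub_eq hg h).antisymm
    (modifications_subset_of_sub_eq hf fun x i hx => (h x i hx).symm)

lemma numMod_box_congr {n : ℕ} (hf : HasSteps f) (hg : HasSteps g) {c : ℤ}
    (h : ∀ x ∈ box d (n + 1), g x = f x + c) : numMod (box d n) f = numMod (box d n) g := by
  refine numMod_congr hf hg fun x i hx => ?_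
  have hx' : x ∈ box d (n + 1) ∧ x + gen i ∈ box d (n + 1) := hx.elim
    (fun hx => ⟨box_mono n.le_succ hx, add_gen_mem_box hx i⟩)
    (fun hx => ⟨mem_box_of_add_gen hx, box_mono n.le_succ hx⟩)
  rw [h _ hx'.1, h _ hx'.2]
  ring

lemma numMod_normalize (R : Finset (Vertex d)) (f : HeightFunction d) :
    numMod R f.normalize = numMod R f :=
  numMod_congr f.normalize.hasSteps f.hasSteps fun x i _ => by
    simp only [HeightFunction.normalize_apply]
    ring

lemma numMod_eq_of_eqOn_compl [NeZero d] {f g : HeightFunction d} (h : ∀ x ∉ R, f x = g x) :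
    numMod R f = numMod R g := by
  rw [← ncard_fixedBdry, ← ncard_fixedBdry]
  congr 1
  ext u
  exact forall₂_congr fun x hx => by rw [h x hx]

lemma hasSteps_comp_add_right {v : Vertex d} : HasSteps (fun x => f (x + v)) ↔ HasSteps f := by
  constructor <;> intro h x i
  · have hv := h (x - v) i
    simp only [sub_add_cancel] at hv
    rwa [show x - v + gen i + v = x + gen i by abel] at hv
  · simpa [add_right_comm] using h (x + v) i

lemma numMod_map_addRight (R : Finset (Vertex d)) (v : Vertex d) (f : Vertex d → ℤ) :
    numMod (R.map (addRightEmbedding v)) f = numMod R fun x => f (x + v) := by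
  have hmem (δ : Vertex d → ℤ) : (fun x => δ (x + v)) ∈ modifications R (fun x => f (x + v)) ↔
      δ ∈ modifications (R.map (addRightEmbedding v) : Set (Vertex d)) f := by
    refine and_congr ⟨fun h x hx => ?_, fun h x hx => h _ (by simpa using hx)⟩
      (hasSteps_comp_add_right (f := f + δ))
    have hxv := h (x - v) fun hxR => hx (Finset.mem_map.mpr ⟨x - v, hxR, sub_add_cancel x v⟩)
    simpa only [sub_add_cancel] using hxv
  refine Set.ncard_congr (fun δ _ x => δ (x + v)) (fun δ => (hmem δ).mpr) ?_ ?_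
  · intro δ ε _ _ h
    ext x
    simpa using congrFun h (x - v)
  · intro δ hδ
    have hδ' : δ = fun x => δ (x + v - v) := by simp
    rw [hδ'] at hδ ⊢
    exact ⟨fun x => δ (x - v), (hmem fun x => δ (x - v)).mp hδ, rfl⟩

lemma numMod_shift (R : Finset (Vertex d)) (v : Vertex d) (f : HeightFunction d) :
    numMod R (shift v f) = numMod (R.map (addRightEmbedding v)) f := by
  rw [numMod_map_addRight]
  refine numMod_congr (shift v f).hasSteps (hasSteps_comp_add_right.mpr f.hasSteps)
    fun x i _ => ?_
  simp only [shift]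
  ring

lemma Separated.add_mem_modifications {S T : Set (Vertex d)} (hST : Separated S T)
    (hδ : δ ∈ modifications S f) (hε : ε ∈ modifications T f) :
    δ + ε ∈ modifications (S ∪ T) f := by
  refine ⟨fun x hx => ?_, fun x i => ?_⟩
  · rw [Set.mem_union, not_or] at hx
    simp [hδ.1 x hx.1, hε.1 x hx.2]
  · simp only [Pi.add_apply]
    by_cases hx : x ∈ S ∨ x + gen i ∈ S
    · simpa [hε.1 x (hST x i hx).1, hε.1 _ (hST x i hx).2] using hδ.2 x i
    · rw [not_or] at hx
      simpa [hδ.1 x hx.1, hδ.1 _ hx.2] using hε.2 x i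

lemma Separated.notMem {S T : Set (Vertex d)} (hST : Separated S T) {x : Vertex d} (hx : x ∈ S) :
    x ∉ T :=
  (hST x 0 (Or.inl hx)).1

lemma numMod_mul_numMod_le [NeZero d] [DecidableEq (Vertex d)]
    (hST : Separated (S : Set (Vertex d)) T) (f : Vertex d → ℤ) :
    numMod S f * numMod T f ≤ numMod (S ∪ T) f := by
  rw [numMod, numMod, ← Set.ncard_prod]
  refine Set.ncard_le_ncard_of_injOn (fun p => p.1 + p.2) (fun p hp => ?_) ?_
    (finite_modifications _ f)
  · rw [Finset.coe_union]
    exact hST.add_mem_modifications hp.1 hp.2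
  · rintro ⟨δ, ε⟩ hp ⟨δ', ε'⟩ hp' h
    obtain ⟨⟨hδ, -⟩, hε, -⟩ := Set.mem_prod.mp hp
    obtain ⟨⟨hδ', -⟩, hε', -⟩ := Set.mem_prod.mp hp'
    dsimp only at hδ hε hδ' hε'
    have hδ_eq : δ = δ' := by
      ext x
      by_cases hx : x ∈ (S : Set (Vertex d))
      · simpa [hε x (hST.notMem hx), hε' x (hST.notMem hx)] using congrFun h x
      · rw [hδ x hx, hδ' x hx]
    subst hδ_eq
    exact Prod.ext rfl (add_left_cancel h)

lemma prod_numMod_le [NeZero d] [DecidableEq (Vertex d)] {ι : Type*} (hf : HasSteps f)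
    {J : Finset ι} {S : ι → Finset (Vertex d)}
    (hS : (J : Set ι).Pairwise fun j k => Separated (S j : Set (Vertex d)) (S k)) :
    ∏ j ∈ J, numMod (S j) f ≤ numMod (J.biUnion S) f := by
  classical
  induction J using Finset.induction_on with
  | empty => exact numMod_pos ∅ hf
  | insert a J ha ih =>
    rw [Finset.prod_insert ha, Finset.biUnion_insert]
    rw [Finset.coe_insert] at hS
    refine (Nat.mul_le_mul_left _ (ih (hS.mono (Set.subset_insert _ _)))).trans
      (numMod_mul_numMod_le (fun x i hx => ?_) f)
    have hsep : ∀ k ∈ J, x ∉ S k ∧ x + gen i ∉ S k := fun k hk =>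
      hS (Set.mem_insert a _) (Set.mem_insert_of_mem a hk) (fun h => ha (h ▸ hk)) x i hx
    simpa using ⟨fun k hk => (hsep k hk).1, fun k hk => (hsep k hk).2⟩

lemma sum_log_numMod_le [NeZero d] {ι : Type*} (hf : HasSteps f) {J : Finset ι}
    {S : ι → Finset (Vertex d)} (hSR : ∀ j ∈ J, S j ⊆ R)
    (hS : (J : Set ι).Pairwise fun j k => Separated (S j : Set (Vertex d)) (S k)) :
    ∑ j ∈ J, Real.log (numMod (S j) f) ≤ Real.log (numMod R f) := by
  classical
  have hpos (j : ι) : (0 : ℝ) < numMod (S j) f := Nat.cast_pos.mpr (numMod_pos _ hf)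
  rw [← Real.log_prod fun j _ => (hpos j).ne']
  refine Real.log_le_log (Finset.prod_pos fun j _ => hpos j) ?_
  exact_mod_cast (prod_numMod_le hf hS).trans (numMod_mono (Finset.biUnion_subset.mpr hSR) f)

lemma log_numMod_le [NeZero d] (R : Finset (Vertex d)) (f : Vertex d → ℤ) :
    Real.log (numMod R f) ≤ R.card * Real.log 2 := by
  rcases (numMod R f).eq_zero_or_pos with h | h
  · rw [h, Nat.cast_zero, Real.log_zero]
    positivity
  · rw [← Real.log_pow]
    exact Real.log_le_log (Nat.cast_pos.mpr h) (by exact_mod_cast numMod_le_two_pow R f)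

lemma numMod_eq_one_of_step_eq_one [NeZero d] (R : Finset (Vertex d)) (hf : HasSteps f)
    {i : Fin (d + 1)} (hstep : ∀ x, f (x + gen i) - f x = 1) : numMod R f = 1 := by
  refine Set.ncard_eq_one.mpr ⟨0, Set.eq_singleton_iff_unique_mem.mpr
    ⟨zero_mem_modifications _ hf, fun δ hδ => ?_⟩⟩
  have hanti (x : Vertex d) : δ (x + gen i) ≤ δ x := by
    have hfδ := hδ.2 x i
    simp only [Pi.add_apply] at hfδ
    have := hstep x
    omega
  have hnonneg : ∀ x, 0 ≤ δ x := forall_of_forall_notMem (gen_ne_zero i)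
    (fun x hx => (hδ.1 x hx).ge) fun x hx => hx.trans (hanti x)
  have hnonpos : ∀ x, δ x ≤ 0 := forall_of_forall_notMem (neg_ne_zero.mpr (gen_ne_zero i))
    (fun x hx => (hδ.1 x hx).le) fun x hx => by simpa using (hanti (x + -gen i)).trans hx
  exact funext fun x => (hnonpos x).antisymm (hnonneg x)

end Modifications

/-! ### The mean logarithm of the number of modifications -/

section Measurability

variable {R : Finset (Vertex d)}

lemma measurable_sub (x y : Vertex d) : Measurable fun f : HeightFunction d => f x - f y :=
  measurable_iff_comap_le.mpr <| le_iSup₂ (f := fun x y : Vertex d => MeasurableSpace.comap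
    (fun f : HeightFunction d => f x - f y) ⊤) x y

lemma measurable_of_forall_sub {Ω : Type*} [MeasurableSpace Ω] {F : Ω → HeightFunction d}
    (h : ∀ x y, Measurable fun ω => F ω x - F ω y) : Measurable F := by
  rw [measurable_iff_comap_le, gradSigma]
  simp only [MeasurableSpace.comap_iSup, MeasurableSpace.comap_comp]
  exact iSup₂_le fun x y => (h x y).comap_le

lemma measurable_diffMap (R : Finset (Vertex d)) : Measurable (diffMap R) :=
  measurable_pi_iff.mpr fun x => measurable_pi_iff.mpr fun y => measurable_sub y.1 x.1

lemma measurable_of_diffMap {β : Type*} [MeasurableSpace β] [Nonempty β]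
    {F : HeightFunction d → β} (h : ∀ f g, diffMap R f = diffMap R g → F f = F g) :
    Measurable F := by
  obtain ⟨e, rfl⟩ := (Function.factorsThrough_iff F).mp fun f g hfg => h f g hfg
  exact (Measurable.of_discrete (f := e)).comp (measurable_diffMap R)

lemma diffMap_eq_iff {f g : HeightFunction d} :
    diffMap R f = diffMap R g ↔ ∀ x ∈ R, ∀ y ∈ R, f y - f x = g y - g x :=
  ⟨fun h x hx y hy => congrFun (congrFun h ⟨x, hx⟩) ⟨y, hy⟩,
    fun h => funext fun x => funext fun y => h x x.2 y y.2⟩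

lemma numMod_box_eq_of_diffMap {n : ℕ} {f g : HeightFunction d}
    (h : diffMap (box d (n + 1)) f = diffMap (box d (n + 1)) g) :
    numMod (box d n) f = numMod (box d n) g := by
  refine numMod_box_congr f.hasSteps g.hasSteps (c := g 0 - f 0) fun x hx => ?_
  have := diffMap_eq_iff.mp h 0 (zero_mem_box n.succ_pos) x hx
  omega

lemma measurable_log_numMod (n : ℕ) :
    Measurable fun f : HeightFunction d => Real.log (numMod (box d n) f) :=
  measurable_of_diffMap fun f g h => by rw [numMod_box_eq_of_diffMap h]

lemma integrable_log_numMod [NeZero d] (μ : Measure (HeightFunction d)) [IsFiniteMeasure μ]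
    (n : ℕ) : Integrable (fun f : HeightFunction d => Real.log (numMod (box d n) f)) μ := by
  refine Integrable.of_bound (measurable_log_numMod n).aestronglyMeasurable
    ((box d n).card * Real.log 2) (Eventually.of_forall fun f => ?_)
  rw [Real.norm_of_nonneg (Real.log_natCast_nonneg _)]
  exact log_numMod_le _ f

end Measurability

section Shift

lemma shift_neg_shift (x : Vertex d) (f : HeightFunction d) : shift (-x) (shift x f) = f := by
  ext y
  simp only [shift, neg_add_cancel_right, zero_add, neg_add_cancel]
  ring

lemma shift_shift_neg (x : Vertex d) (f : HeightFunction d) : shift x (shift (-x) f) = f := by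
  simpa using shift_neg_shift (-x) f

lemma measurable_shift (x : Vertex d) : Measurable (shift x : HeightFunction d → _) := by
  refine measurable_of_forall_sub fun y z => ?_
  convert measurable_sub (y + x) (z + x) using 2
  simp only [shift]
  ring

lemma IsShiftInvariant.measurePreserving {μ : Measure (HeightFunction d)}
    (h : IsShiftInvariant μ) (x : Vertex d) : MeasurePreserving (shift x) μ μ := by
  refine ⟨measurable_shift x, Measure.ext fun A hA => ?_⟩
  rw [Measure.map_apply (measurable_shift x) hA,
    ← Set.image_eq_preimage_of_inverse (shift_shift_neg x) (shift_neg_shift x)]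
  exact h (-x) A hA

end Shift

/-- The mean `∫ log |Ω(Πₙ, f)| dμ(f)`. -/
def meanLog (μ : Measure (HeightFunction d)) (n : ℕ) : ℝ :=
  ∫ f, Real.log (numMod (box d n) f) ∂μ

lemma meanLog_le [NeZero d] (μ : Measure (HeightFunction d)) [IsProbabilityMeasure μ] (n : ℕ) :
    meanLog μ n ≤ (2 * n : ℝ) ^ d * Real.log 2 := by
  have h : meanLog μ n ≤ ∫ _f, ((box d n).card : ℝ) * Real.log 2 ∂μ :=
    integral_mono (integrable_log_numMod μ n) (integrable_const _) fun f => log_numMod_le _ f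
  rw [card_box] at h
  simpa using h

section Tiling

variable {k n m : ℕ}

/-- The `j`-th of the `k ^ d` translates of `Πₙ` that tile `Π_m` from its lower corner on. The
period `2 * n + 1` exceeds the side length `2 * n` by one, so that distinct tiles are separated. -/
def tile (n m : ℕ) (j : Fin d → Fin k) : Finset (Vertex d) :=
  (box d n).map (addRightEmbedding (ofCoord fun i => (n : ℤ) - m + (2 * n + 1) * (j i : ℕ)))

lemma coord_add_mem_Ico_of_mem_tile {j : Fin d → Fin k} {x : Vertex d} (hx : x ∈ tile n m j)
    (i : Fin d) : coord d x i + m ∈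
      Set.Ico ((2 * n + 1) * ((j i : ℕ) : ℤ)) ((2 * n + 1) * ((j i : ℕ) : ℤ) + 2 * n) := by
  obtain ⟨y, hy, rfl⟩ := Finset.mem_map.mp hx
  have hyi := mem_box.mp hy i
  rw [addRightEmbedding_apply, map_add, Pi.add_apply, coord_ofCoord]
  constructor <;> linarith

lemma tile_subset_box (h : k * (2 * n + 1) ≤ 2 * m) (j : Fin d → Fin k) :
    tile n m j ⊆ box d m := by
  refine fun x hx => mem_box.mpr fun i => ?_
  obtain ⟨hlower, hupper⟩ := coord_add_mem_Ico_of_mem_tile hx i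
  have hj : ((j i : ℕ) : ℤ) + 1 ≤ k := by exact_mod_cast (j i).2
  have hk : (k : ℤ) * (2 * n + 1) ≤ 2 * m := by exact_mod_cast h
  have hj0 : (0 : ℤ) ≤ (2 * n + 1) * ((j i : ℕ) : ℤ) := by positivity
  have htop : (2 * n + 1) * (((j i : ℕ) : ℤ) + 1) ≤ (2 * n + 1) * k := by gcongr
  exact ⟨by linarith, by linarith [hk]⟩

lemma eq_of_mem_tile {j l : Fin d → Fin k} {x y : Vertex d} (hx : x ∈ tile n m j)
    (hy : y ∈ tile n m l) (hxy : ∀ i, |coord d y i - coord d x i| ≤ 1) : j = l := by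
  ext i
  obtain ⟨hx₁, hx₂⟩ := coord_add_mem_Ico_of_mem_tile hx i
  obtain ⟨hy₁, hy₂⟩ := coord_add_mem_Ico_of_mem_tile hy i
  obtain ⟨h₁, h₂⟩ := abs_le.mp (hxy i)
  by_contra hne
  rcases Nat.lt_or_gt_of_ne hne with hlt | hlt
  · have : ((j i : ℕ) : ℤ) + 1 ≤ (l i : ℕ) := by exact_mod_cast hlt
    nlinarith
  · have : ((l i : ℕ) : ℤ) + 1 ≤ (j i : ℕ) := by exact_mod_cast hlt
    nlinarith

lemma separated_tile {j l : Fin d → Fin k} (hjl : j ≠ l) :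
    Separated (tile n m j : Set (Vertex d)) (tile n m l) := by
  intro x i hx
  have hstep (i' : Fin d) : |coord d (gen i) i'| ≤ 1 := abs_le.mpr (coord_gen_mem_Icc i i')
  rcases hx with hx | hx
  · exact ⟨fun hy => hjl (eq_of_mem_tile hx hy fun i' => by simp),
      fun hy => hjl (eq_of_mem_tile hx hy fun i' => by simpa using hstep i')⟩
  · exact ⟨fun hy => hjl (eq_of_mem_tile hx hy fun i' => by simpa using hstep i'),
      fun hy => hjl (eq_of_mem_tile hx hy fun i' => by simp)⟩

lemma sum_log_numMod_tile_le [NeZero d] (h : k * (2 * n + 1) ≤ 2 * m) (f : HeightFunction d) :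
    ∑ j : Fin d → Fin k, Real.log (numMod (tile n m j) f) ≤ Real.log (numMod (box d m) f) :=
  sum_log_numMod_le f.hasSteps (fun j _ => tile_subset_box h j) fun _ _ _ _ => separated_tile

lemma IsShiftInvariant.integral_log_numMod_shift {μ : Measure (HeightFunction d)}
    (hμ : IsShiftInvariant μ) (v : Vertex d) :
    ∫ f, Real.log (numMod (box d n) (shift v f)) ∂μ = meanLog μ n := by
  have hv := hμ.measurePreserving v
  rw [meanLog, ← integral_map (φ := shift v) (f := fun f => Real.log (numMod (box d n) f))
    hv.aemeasurable (measurable_log_numMod n).aestronglyMeasurable, hv.map_eq]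

lemma IsShiftInvariant.pow_mul_meanLog_le [NeZero d] {μ : Measure (HeightFunction d)}
    [IsFiniteMeasure μ] (hμ : IsShiftInvariant μ) (h : k * (2 * n + 1) ≤ 2 * m) :
    (k : ℝ) ^ d * meanLog μ n ≤ meanLog μ m := by
  have hint (v : Vertex d) : Integrable (fun f => Real.log (numMod (box d n) (shift v f))) μ :=
    (hμ.measurePreserving v).integrable_comp_of_integrable (integrable_log_numMod μ n)
  have hle : ∫ f, ∑ j : Fin d → Fin k, Real.log (numMod (box d n)
        (shift (ofCoord fun i => (n : ℤ) - m + (2 * n + 1) * (j i : ℕ)) f)) ∂μ ≤ meanLog μ m :=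
    integral_mono (integrable_finsetSum _ fun j _ => hint _) (integrable_log_numMod μ m)
      fun f => by
        simp only [numMod_shift]
        exact sum_log_numMod_tile_le h f
  rw [integral_finsetSum _ fun j _ => hint _] at hle
  simpa [hμ.integral_log_numMod_shift] using hle

lemma exists_tendsto_meanLog [NeZero d] {μ : Measure (HeightFunction d)}
    [IsProbabilityMeasure μ] (hμ : IsShiftInvariant μ) :
    ∃ t, Tendsto (fun n : ℕ => meanLog μ n / (2 * n) ^ d) atTop (𝓝 t) := by
  refine ⟨_, tendsto_div_pow_iSup ⟨Real.log 2, ?_⟩ fun k n m => hμ.pow_mul_meanLog_le⟩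
  rintro _ ⟨n, rfl⟩
  rw [div_le_iff₀ (by positivity), mul_comm]
  refine (meanLog_le μ n).trans ?_
  gcongr
  linarith

end Tiling

/-! ### Entropy in a box and in its boundary layer -/

section Entropy

variable {R S : Finset (Vertex d)} {f g u : HeightFunction d} {n : ℕ}

/-- The height functions that have the gradient of `f` on `R`, an atom of the σ-algebra generated
by `D_R`. -/
def gradCylinder (R : Finset (Vertex d)) (f : HeightFunction d) : Set (HeightFunction d) :=
  {g | diffMap R g = diffMap R f}

lemma mem_gradCylinder : g ∈ gradCylinder R f ↔ ∀ x ∈ R, ∀ y ∈ R, g y - g x = f y - f x :=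
  diffMap_eq_iff

lemma gradCylinder_anti (h : R ⊆ S) : gradCylinder S f ⊆ gradCylinder R f := fun _ hg =>
  mem_gradCylinder.mpr fun x hx y hy => mem_gradCylinder.mp hg x (h hx) y (h hy)

lemma measurableSet_gradCylinder (R : Finset (Vertex d)) (f : HeightFunction d) :
    MeasurableSet (gradCylinder R f) :=
  measurable_diffMap R (MeasurableSet.singleton _)

lemma finite_range_diffMap (R : Finset (Vertex d)) : (Set.range (diffMap R)).Finite := by
  refine (Set.Finite.pi' fun x : R => Set.Finite.pi' fun y : R => Set.finite_Icc
    (-(d * (latticeGraph d).dist x.1 y.1 : ℤ)) (d * (latticeGraph d).dist x.1 y.1)).subset ?_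
  rintro _ ⟨f, rfl⟩ x y
  exact abs_le.mp (f.hasSteps.abs_sub_le_mul_dist x.1 y.1)

lemma ncard_range_diffMap_le (hR : R ⊆ box d n) :
    (Set.range (diffMap R)).ncard ≤ (2 * (d * (d * n)) + 1) ^ R.card := by
  classical
  set M : ℕ := d * (d * n)
  let Z : Finset (R → R → ℤ) :=
    (Fintype.piFinset fun _ : R => Finset.Icc (-(M : ℤ)) M).image fun a x y => a y - a x
  have hsub : Set.range (diffMap R) ⊆ Z := by
    rintro _ ⟨f, rfl⟩
    refine Finset.mem_coe.mpr (Finset.mem_image.mpr ⟨fun x => f x - f 0, ?_, ?_⟩)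
    · refine Fintype.mem_piFinset.mpr fun x => Finset.mem_Icc.mpr (abs_le.mp ?_)
      simpa [M] using f.abs_sub_zero_le (hR x.2)
    · ext x y
      simp [diffMap]
  have hM : ((M : ℤ) + 1 + M).toNat = 2 * M + 1 := by omega
  calc (Set.range (diffMap R)).ncard ≤ Z.card := by
        simpa using Set.ncard_le_ncard hsub Z.finite_toSet
    _ ≤ (2 * M + 1) ^ R.card := Finset.card_image_le.trans (by simp [hM])

lemma entropyIn_eq_sum (R : Finset (Vertex d)) (μ : Measure (HeightFunction d)) :
    entropyIn R μ = ∑ z ∈ (finite_range_diffMap R).toFinset,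
      μ.real (diffMap R ⁻¹' {z}) * Real.log (μ.real (diffMap R ⁻¹' {z})) :=
  finsum_mem_eq_finite_toFinset_sum _ _

lemma entropyIn_eq_integral (R : Finset (Vertex d)) (μ : Measure (HeightFunction d))
    [IsFiniteMeasure μ] :
    entropyIn R μ = ∫ f, Real.log (μ.real (gradCylinder R f)) ∂μ := by
  rw [entropyIn_eq_sum]
  exact (integral_comp_eq_sum (measurable_diffMap R) (by simp)
    fun z => Real.log (μ.real (diffMap R ⁻¹' {z}))).symm

lemma entropyIn_nonpos (R : Finset (Vertex d)) (μ : Measure (HeightFunction d))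
    [IsProbabilityMeasure μ] : entropyIn R μ ≤ 0 := by
  rw [entropyIn_eq_sum]
  exact Finset.sum_nonpos fun z _ => mul_nonpos_of_nonneg_of_nonpos measureReal_nonneg
    (Real.log_nonpos measureReal_nonneg measureReal_le_one)

lemma neg_log_ncard_range_le_entropyIn (R : Finset (Vertex d)) (μ : Measure (HeightFunction d))
    [IsProbabilityMeasure μ] :
    -Real.log (Set.range (diffMap R)).ncard ≤ entropyIn R μ := by
  rw [entropyIn_eq_sum, Set.ncard_eq_toFinset_card _ (finite_range_diffMap R)]
  exact neg_log_card_le_sum_mul_log (fun _ _ => measureReal_nonneg)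
    (sum_measureReal_preimage_eq_one (measurable_diffMap R) (by simp))

lemma abs_entropyIn_le (hR : R ⊆ box d n) (μ : Measure (HeightFunction d))
    [IsProbabilityMeasure μ] :
    |entropyIn R μ| ≤ R.card * Real.log (2 * (d * (d * n)) + 1) := by
  have : Nonempty (HeightFunction d) := μ.nonempty_of_neZero
  have hpos : 0 < (Set.range (diffMap R)).ncard :=
    (Set.ncard_pos (finite_range_diffMap R)).mpr (Set.range_nonempty _)
  rw [abs_of_nonpos (entropyIn_nonpos R μ), ← Real.log_pow]
  refine (neg_le.mp (neg_log_ncard_range_le_entropyIn R μ)).trans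
    (Real.log_le_log (Nat.cast_pos.mpr hpos) ?_)
  exact_mod_cast ncard_range_diffMap_le hR

lemma integrable_log_gradCylinder (R : Finset (Vertex d)) (μ : Measure (HeightFunction d))
    [IsFiniteMeasure μ] : Integrable (fun f => Real.log (μ.real (gradCylinder R f))) μ := by
  have hmeas : Measurable fun f => Real.log (μ.real (gradCylinder R f)) :=
    measurable_of_diffMap fun f g h => by rw [gradCylinder, h, gradCylinder]
  obtain ⟨C, hC⟩ := ((finite_range_diffMap R).image fun z =>
    ‖Real.log (μ.real (diffMap R ⁻¹' {z}))‖).bddAbove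
  exact Integrable.of_bound hmeas.aestronglyMeasurable C
    (Eventually.of_forall fun f => hC ⟨_, ⟨f, rfl⟩, rfl⟩)

open Classical in
/-- The boundary layer `Πₙ₊₁ ∖ Πₙ`. -/
def shell (d n : ℕ) : Finset (Vertex d) := box d (n + 1) \ box d n

lemma mem_shell {x : Vertex d} : x ∈ shell d n ↔ x ∈ box d (n + 1) ∧ x ∉ box d n := by
  classical
  exact Finset.mem_sdiff

lemma shell_subset_box (d n : ℕ) : shell d n ⊆ box d (n + 1) := fun _ hx => (mem_shell.mp hx).1

lemma shell_nonempty [NeZero d] (n : ℕ) : (shell d n).Nonempty := by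
  refine ⟨ofCoord fun _ => n, mem_shell.mpr ⟨mem_box.mpr fun i => ?_, fun h => ?_⟩⟩
  · rw [coord_ofCoord]
    push_cast
    omega
  · have h0 := mem_box.mp h 0
    rw [coord_ofCoord] at h0
    omega

lemma card_shell (d n : ℕ) :
    ((shell d n).card : ℝ) = (2 * (n + 1)) ^ d - (2 * n) ^ d := by
  classical
  rw [shell, Finset.card_sdiff_of_subset (box_mono n.le_succ),
    Nat.cast_sub (Finset.card_le_card (box_mono n.le_succ)), card_box, card_box]
  push_cast
  ring

/-- Bernoulli's inequality for `(n / (n + 1)) ^ d`. -/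
lemma card_shell_le (d n : ℕ) :
    ((shell d n).card : ℝ) ≤ (2 * (n + 1)) ^ d * (d / (n + 1)) := by
  have hn : (0 : ℝ) < n + 1 := by positivity
  have hBernoulli := one_add_mul_le_pow (a := -(1 / ((n : ℝ) + 1)))
    (by rw [neg_le_neg_iff, div_le_iff₀ hn]; linarith) d
  have hpow : (2 * n : ℝ) ^ d = (2 * (n + 1) : ℝ) ^ d * (1 + -(1 / ((n : ℝ) + 1))) ^ d := by
    rw [← mul_pow]
    congr 1
    field_simp
    ring
  rw [card_shell, hpow, sub_le_iff_le_add, ← mul_add]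
  refine le_mul_of_one_le_right (by positivity) (le_trans (le_of_eq ?_)
    (add_le_add_right hBernoulli _))
  ring

lemma exists_mem_fixedBdry_gradCylinder [NeZero d] (h : g ∈ gradCylinder (shell d n) f) :
    ∃ u ∈ fixedBdry (box d n : Set (Vertex d)) g, u ∈ gradCylinder (box d (n + 1)) f := by
  obtain ⟨b, hb⟩ := shell_nonempty (d := d) n
  let f' := f.addConst (g b - f b) (g.dvd_sub f b)
  have hf' (x : Vertex d) : f' x = f x + (g b - f b) := rfl
  have hshell : ∀ x ∈ shell d n, f' x = g x := fun x hx => by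
    have := mem_gradCylinder.mp h b hb x hx
    have := hf' x
    omega
  let u := HeightFunction.glue (box d n) f' g
    (fun x hx i hi => hshell _ (mem_shell.mpr ⟨add_gen_mem_box hx i, hi⟩))
    (fun x hx i hi => hshell _ (mem_shell.mpr ⟨mem_box_of_add_gen hi, hx⟩))
  have hin : ∀ x ∈ box d n, u x = f' x := fun x hx => if_pos hx
  have hout : ∀ x ∉ box d n, u x = g x := fun x hx => if_neg hx
  have hbox : ∀ x ∈ box d (n + 1), u x = f' x := fun x hx => by
    by_cases hxn : x ∈ box d n
    · exact hin x hxn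
    · rw [hout x hxn, hshell x (mem_shell.mpr ⟨hx, hxn⟩)]
  refine ⟨u, hout, mem_gradCylinder.mpr fun x hx y hy => ?_⟩
  rw [hbox x hx, hbox y hy, hf', hf']
  ring

lemma eq_of_mem_fixedBdry_of_mem_gradCylinder [NeZero d] {w : HeightFunction d}
    (hu : u ∈ fixedBdry (box d n : Set (Vertex d)) g) (hu' : u ∈ gradCylinder (box d (n + 1)) f)
    (hw : w ∈ fixedBdry (box d n : Set (Vertex d)) g) (hw' : w ∈ gradCylinder (box d (n + 1)) f) :
    w = u := by
  obtain ⟨b, hb⟩ := shell_nonempty (d := d) n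
  obtain ⟨hb₁, hb₀⟩ := mem_shell.mp hb
  ext x
  by_cases hx : x ∈ box d n
  · have hux := mem_gradCylinder.mp hu' b hb₁ x (box_mono n.le_succ hx)
    have hwx := mem_gradCylinder.mp hw' b hb₁ x (box_mono n.le_succ hx)
    have hub := hu b hb₀
    have hwb := hw b hb₀
    omega
  · rw [hu x hx, hw x hx]

lemma gibbsKernel_of_mem_gradCylinder [NeZero d] (h : g ∈ gradCylinder (shell d n) f) :
    gibbsKernel (box d n) (gradCylinder (box d (n + 1)) f) g = (numMod (box d n) f : ℝ≥0∞)⁻¹ := by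
  obtain ⟨u, hu, hu'⟩ := exists_mem_fixedBdry_gradCylinder h
  have hsingleton :
      fixedBdry (box d n : Set (Vertex d)) g ∩ gradCylinder (box d (n + 1)) f = {u} :=
    Set.eq_singleton_iff_unique_mem.mpr ⟨⟨hu, hu'⟩, fun w hw =>
      eq_of_mem_fixedBdry_of_mem_gradCylinder hu hu' hw.1 hw.2⟩
  have hnumMod : numMod (box d n) g = numMod (box d n) f :=
    (numMod_eq_of_eqOn_compl fun x hx => (hu x hx).symm).trans (numMod_box_eq_of_diffMap hu')
  rw [gibbsKernel, hsingleton, ncard_fixedBdry, hnumMod, Set.ncard_singleton, Nat.cast_one,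
    one_div]

lemma gibbsKernel_of_notMem_gradCylinder (h : g ∉ gradCylinder (shell d n) f) :
    gibbsKernel (box d n) (gradCylinder (box d (n + 1)) f) g = 0 := by
  have hempty : fixedBdry (box d n : Set (Vertex d)) g ∩ gradCylinder (box d (n + 1)) f = ∅ := by
    refine Set.eq_empty_of_forall_notMem fun u ⟨hu, hu'⟩ => h (mem_gradCylinder.mpr ?_)
    intro x hx y hy
    rw [← hu x (mem_shell.mp hx).2, ← hu y (mem_shell.mp hy).2]
    exact mem_gradCylinder.mp (gradCylinder_anti (shell_subset_box d n) hu') x hx y hy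
  rw [gibbsKernel, hempty, Set.ncard_empty, Nat.cast_zero, ENNReal.zero_div]

lemma IsGradientGibbs.measureReal_gradCylinder_box [NeZero d] {μ : Measure (HeightFunction d)}
    (hμ : IsGradientGibbs μ) (n : ℕ) (f : HeightFunction d) :
    μ.real (gradCylinder (box d (n + 1)) f) =
      μ.real (gradCylinder (shell d n) f) / numMod (box d n) f := by
  have hkernel : gibbsKernel (box d n) (gradCylinder (box d (n + 1)) f) =
      (gradCylinder (shell d n) f).indicator fun _ => (numMod (box d n) f : ℝ≥0∞)⁻¹ := by
    ext g
    by_cases hg : g ∈ gradCylinder (shell d n) f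
    · rw [Set.indicator_of_mem hg, gibbsKernel_of_mem_gradCylinder hg]
    · rw [Set.indicator_of_notMem hg, gibbsKernel_of_notMem_gradCylinder hg]
  rw [measureReal_def, hμ _ _ (measurableSet_gradCylinder _ _), hkernel,
    lintegral_indicator_const (measurableSet_gradCylinder _ _), ENNReal.toReal_mul,
    ENNReal.toReal_inv, ENNReal.toReal_natCast, mul_comm, div_eq_mul_inv, measureReal_def]

lemma IsGradientGibbs.entropyIn_box_succ [NeZero d] {μ : Measure (HeightFunction d)}
    [IsFiniteMeasure μ] (hμ : IsGradientGibbs μ) (n : ℕ) :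
    entropyIn (box d (n + 1)) μ = entropyIn (shell d n) μ - meanLog μ n := by
  rw [entropyIn_eq_integral, entropyIn_eq_integral, meanLog,
    ← integral_sub (integrable_log_gradCylinder _ μ) (integrable_log_numMod μ n)]
  refine integral_congr_ae ?_
  filter_upwards [ae_measureReal_preimage_pos (measurable_diffMap (shell d n))] with f hf
  rw [hμ.measureReal_gradCylinder_box]
  exact Real.log_div hf.ne' (Nat.cast_pos.mpr (numMod_pos _ f.hasSteps)).ne'

lemma tendsto_entropyIn_shell_div (μ : Measure (HeightFunction d)) [IsProbabilityMeasure μ] :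
    Tendsto (fun n : ℕ => entropyIn (shell d n) μ / (2 * (n + 1)) ^ d) atTop (𝓝 0) := by
  have hlim := (((tendsto_log_mul_add_one_div (c := 2 * (d * d)) (by positivity)).comp
    (tendsto_add_atTop_nat 1)).const_mul (d : ℝ))
  rw [mul_zero] at hlim
  refine squeeze_zero_norm (fun n => ?_) hlim
  have hpos : (0 : ℝ) < (2 * (n + 1)) ^ d := by positivity
  rw [Real.norm_eq_abs, abs_div, abs_of_pos hpos, div_le_iff₀ hpos]
  calc |entropyIn (shell d n) μ|
      ≤ (shell d n).card * Real.log (2 * (d * (d * (n + 1 : ℕ))) + 1) :=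
        abs_entropyIn_le (shell_subset_box d n) μ
    _ ≤ (2 * (n + 1)) ^ d * (d / (n + 1)) * Real.log (2 * (d * (d * (n + 1 : ℕ))) + 1) := by
        refine mul_le_mul_of_nonneg_right (card_shell_le d n) (Real.log_nonneg ?_)
        exact le_add_of_nonneg_left (by positivity)
    _ = d * (Real.log (2 * (d * d) * (n + 1 : ℕ) + 1) / (n + 1 : ℕ)) * (2 * (n + 1)) ^ d := by
        rw [show (2 * (d * d) * (n + 1 : ℕ) + 1 : ℝ) = 2 * (d * (d * (n + 1 : ℕ))) + 1 by ring]
        push_cast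
        ring

lemma IsGradientGibbs.tendsto_entropyIn_box [NeZero d] {μ : Measure (HeightFunction d)}
    [IsProbabilityMeasure μ] (hμ : IsGradientGibbs μ) {t : ℝ}
    (ht : Tendsto (fun n : ℕ => meanLog μ n / (2 * n) ^ d) atTop (𝓝 t)) :
    Tendsto (fun n : ℕ => 1 / ((box d n).card : ℝ) * entropyIn (box d n) μ) atTop (𝓝 (-t)) := by
  rw [← tendsto_add_atTop_iff_nat 1, ← zero_sub]
  refine ((tendsto_entropyIn_shell_div μ).sub (tendsto_div_succ_pow ht)).congr fun n => ?_
  rw [hμ.entropyIn_box_succ, card_box]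
  push_cast
  ring

lemma specificEntropy_eq_of_tendsto {μ : Measure (HeightFunction d)} {l : ℝ} (h : Tendsto
    (fun n : ℕ => 1 / ((box d n).card : ℝ) * entropyIn (box d n) μ) atTop (𝓝 l)) :
    specificEntropy μ = l := by
  rw [specificEntropy, if_pos ⟨l, h⟩, h.limUnder_eq]

end Entropy

/-! ### Attachment of height functions to an affine boundary -/

/-- The height function `⌊s⌋`. -/
abbrev slopeFloor {s : Slope d} (hs : s ∈ lipSlopes d) : HeightFunction d :=
  lipFloor (fun x => s (embed d x)) (isLip_of_mem hs)

lemma lipFloor_congr {F G : Vertex d → ℝ} (hF : IsLip F) (hG : IsLip G) {x : Vertex d}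
    (h : F x = G x) : lipFloor F hF x = lipFloor G hG x := by
  simp only [lipFloor, floorVal, h]

lemma le_lipFloor_of_add_le {F : Vertex d → ℝ} (hF : IsLip F) {x : Vertex d} {k : ℤ}
    (h : k + (d + 1) ≤ F x) : k ≤ lipFloor F hF x := by
  have : (k : ℝ) < floorVal F x := by linarith [lt_floorVal F x]
  exact_mod_cast this.le

lemma lipFloor_le_of_le {F : Vertex d → ℝ} (hF : IsLip F) {x : Vertex d} {k : ℤ}
    (h : F x ≤ k) : lipFloor F hF x ≤ k := by
  exact_mod_cast (floorVal_le F x).trans h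

/-- Truncation of `f` to the band `F - ψ ≤ f ≤ F + ψ`. -/
lemma exists_truncation {F ψ : Vertex d → ℝ} (hF : IsLip F) (hadd : IsLip (F + ψ))
    (hsub : IsLip (F - ψ)) (f : HeightFunction d) :
    ∃ g : HeightFunction d, (∀ x, ψ x = 0 → g x = lipFloor F hF x) ∧
      ∀ x, |f x - F x| + (d + 1) ≤ ψ x → g x = f x := by
  refine ⟨max (min f (lipFloor _ hadd)) (lipFloor _ hsub), fun x hx => ?_, fun x hx => ?_⟩
  · rw [HeightFunction.max_apply, HeightFunction.min_apply,
      lipFloor_congr hadd hF (by simp [hx]), lipFloor_congr hsub hF (by simp [hx])]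
    exact max_eq_right (min_le_right _ _)
  · have hle : f x ≤ lipFloor _ hadd x := le_lipFloor_of_add_le hadd <| by
      rw [Pi.add_apply]
      linarith [le_abs_self (f x - F x)]
    have hge : lipFloor _ hsub x ≤ f x := lipFloor_le_of_le hsub <| by
      rw [Pi.sub_apply]
      linarith [neg_abs_le (f x - F x), d.cast_nonneg (α := ℝ)]
    rw [HeightFunction.max_apply, HeightFunction.min_apply, min_eq_left hle, max_eq_left hge]

lemma abs_mul_max_sub_le {η a b : ℝ} (hη : 0 ≤ η) (h : |a - b| ≤ 1) :
    |η * max a 0 - η * max b 0| ≤ η := by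
  rw [← mul_sub, abs_mul, abs_of_nonneg hη]
  exact mul_le_of_le_one_right hη ((abs_max_sub_max_le_abs a b 0).trans h)

section Slack

variable {s : Slope d} {η : ℝ}

lemma isLip_slope_add (hη : ∀ i, s (embed d (gen i)) + η ≤ 1) {ψ : Vertex d → ℝ}
    (hψ : ∀ x i, ψ (x + gen i) - ψ x ≤ η) : IsLip ((fun x => s (embed d x)) + ψ) := by
  intro x i
  simp only [Pi.add_apply, map_add]
  linarith [hψ x i, hη i]

lemma exists_slope_truncation (hs : s ∈ lipSlopes d) (hη : ∀ i, s (embed d (gen i)) + η ≤ 1)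
    {ψ : Vertex d → ℝ} (hψ : ∀ x i, |ψ (x + gen i) - ψ x| ≤ η) (f : HeightFunction d) :
    ∃ g : HeightFunction d, (∀ x, ψ x = 0 → g x = slopeFloor hs x) ∧
      ∀ x, |f x - s (embed d x)| + (d + 1) ≤ ψ x → g x = f x := by
  refine exists_truncation (isLip_of_mem hs)
    (isLip_slope_add hη fun x i => (le_abs_self _).trans (hψ x i)) ?_ f
  rw [sub_eq_add_neg]
  refine isLip_slope_add hη fun x i => ?_
  simp only [Pi.neg_apply]
  linarith [neg_abs_le (ψ (x + gen i) - ψ x), hψ x i]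

variable [NeZero d] {m n : ℕ} {f : HeightFunction d}

/-- The truncation with `ψ = η (m - ‖x‖)⁺` attaches `f` inside to `⌊s⌋` outside. -/
lemma numMod_le_numMod_slopeFloor (hs : s ∈ lipSlopes d) (hη0 : 0 ≤ η)
    (hη : ∀ i, s (embed d (gen i)) + η ≤ 1) (hnm : n ≤ m)
    (hf : ∀ x ∈ box d (n + 1), |f x - s (embed d x)| + (d + 1) ≤ η * (m - n - 1)) :
    numMod (box d n) f ≤ numMod (box d m) (slopeFloor hs) := by
  obtain ⟨g, hg_out, hg_in⟩ := exists_slope_truncation hs hη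
    (ψ := fun x => η * max (m - ‖coord d x‖) 0)
    (fun x i => abs_mul_max_sub_le hη0 (by
      rw [sub_sub_sub_cancel_left, abs_sub_comm]
      exact abs_norm_coord_add_gen_sub_le x i)) f
  have hgf : ∀ x ∈ box d (n + 1), g x = f x + 0 := fun x hx => by
    rw [add_zero]
    refine hg_in x ((hf x hx).trans (mul_le_mul_of_nonneg_left (le_max_of_le_left ?_) hη0))
    have := norm_coord_le_of_mem_box hx
    push_cast at this
    linarith
  have hgs : ∀ x ∉ box d m, g x = slopeFloor hs x := fun x hx => hg_out x <| by
    rw [max_eq_right (sub_nonpos.mpr (le_norm_coord_of_notMem_box hx)), mul_zero]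
  calc numMod (box d n) f = numMod (box d n) g := numMod_box_congr f.hasSteps g.hasSteps hgf
    _ ≤ numMod (box d m) g := numMod_mono (box_mono hnm) _
    _ = numMod (box d m) (slopeFloor hs) := numMod_eq_of_eqOn_compl hgs

/-- The truncation with `ψ = η (‖x‖ - (n + 1))⁺` attaches `⌊s⌋` inside to `f` outside. -/
lemma numMod_slopeFloor_le_numMod (hs : s ∈ lipSlopes d) (hη0 : 0 ≤ η)
    (hη : ∀ i, s (embed d (gen i)) + η ≤ 1) (hnm : n + 1 ≤ m)
    (hf : ∀ x ∈ box d (m + 1), |f x - s (embed d x)| + (d + 1) ≤ η * (m - n - 1)) :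
    numMod (box d n) (slopeFloor hs) ≤ numMod (box d m) f := by
  obtain ⟨g, hg_in, hg_out⟩ := exists_slope_truncation hs hη
    (ψ := fun x => η * max (‖coord d x‖ - (n + 1)) 0)
    (fun x i => abs_mul_max_sub_le hη0 (by
      rw [sub_sub_sub_cancel_right]
      exact abs_norm_coord_add_gen_sub_le x i)) f
  have hgs : ∀ x ∈ box d (n + 1), g x = slopeFloor hs x := fun x hx => hg_in x <| by
    have := norm_coord_le_of_mem_box hx
    push_cast at this
    rw [max_eq_right (sub_nonpos.mpr this), mul_zero]
  have hgf : ∀ x ∈ box d (m + 1), x ∉ box d m → g x = f x := fun x hx hxm => by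
    refine hg_out x ((hf x hx).trans (mul_le_mul_of_nonneg_left (le_max_of_le_left ?_) hη0))
    linarith [le_norm_coord_of_notMem_box hxm]
  let u := HeightFunction.glue (box d m : Set (Vertex d)) g f
    (fun x hx i hi => hgf _ (add_gen_mem_box hx i) (by simpa using hi))
    (fun x hx i hi => hgf _ (mem_box_of_add_gen hi) (by simpa using hx))
  have hus : ∀ x ∈ box d (n + 1), u x = slopeFloor hs x + 0 := fun x hx => by
    rw [add_zero, ← hgs x hx]
    exact if_pos (box_mono hnm hx)
  have huf : ∀ x ∉ box d m, u x = f x := fun x hx => if_neg hx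
  calc numMod (box d n) (slopeFloor hs) = numMod (box d n) u :=
        numMod_box_congr (slopeFloor hs).hasSteps u.hasSteps hus
    _ ≤ numMod (box d m) u := numMod_mono (box_mono (by omega)) _
    _ = numMod (box d m) f := numMod_eq_of_eqOn_compl huf

end Slack

/-! ### Concentration -/

/-- The event that the increments of `f` from the origin deviate from the slope `s` by more than `r`
somewhere in `Πₙ`. -/
def deviation (s : Slope d) (n : ℕ) (r : ℝ) : Set (HeightFunction d) :=
  ⋃ x ∈ box d n, {f | r < |((f x - f 0 : ℤ) : ℝ) - s (embed d x)|}

/-- The deviations from the slope `s` in `Πₙ` are `o(n)` in probability. -/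
def ConcentratesOnSlope (μ : Measure (HeightFunction d)) (s : Slope d) : Prop :=
  ∀ δ : ℝ, 0 < δ → Tendsto (fun n : ℕ => μ.real (deviation s n (δ * n))) atTop (𝓝 0)

section Concentration

variable {μ : Measure (HeightFunction d)} {s : Slope d} {n : ℕ} {r : ℝ}

lemma measurableSet_deviation (s : Slope d) (n : ℕ) (r : ℝ) :
    MeasurableSet (deviation s n r) :=
  Finset.measurableSet_biUnion _ fun x _ =>
    measurable_sub x 0 (t := {k : ℤ | r < |(k : ℝ) - s (embed d x)|}) trivial

lemma abs_normalize_sub_le {f : HeightFunction d} (hf : f ∉ deviation s n r) {x : Vertex d}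
    (hx : x ∈ box d n) : |(f.normalize x : ℝ) - s (embed d x)| ≤ r := by
  by_contra h
  exact hf (Set.mem_biUnion hx (not_le.mp h))

lemma IsConcentratedGibbs.measureReal_le_abs_sub_le (hμ : IsConcentratedGibbs μ s) {x y : Vertex d}
    (hxy : 0 < (latticeGraph d).dist x y) {a : ℝ} (ha : 0 ≤ a) :
    μ.real {f | (d + 1) * a ≤ |((f y - f x : ℤ) : ℝ) - s (embed d (y - x))|}
      ≤ 2 * Real.exp (-(a ^ 2 / (2 * (latticeGraph d).dist x y))) := by
  have := hμ.isProb
  have hupper := hμ.upper_tail x y hxy a ha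
  have hlower := hμ.lower_tail x y hxy (-a) (neg_nonpos.mpr ha)
  rw [neg_sq] at hlower
  rw [two_mul]
  refine (measureReal_mono (fun f hf => ?_)).trans
    ((measureReal_union_le _ _).trans (add_le_add hupper hlower))
  rcases le_abs.mp (Set.mem_ofPred.mp hf) with h | h
  · exact Or.inl h
  · right
    rw [Set.mem_ofPred, mul_neg]
    exact le_neg_of_le_neg h

lemma IsConcentratedGibbs.measureReal_lt_abs_sub_le (hμ : IsConcentratedGibbs μ s) {δ : ℝ}
    (hδ : 0 < δ) {x : Vertex d} (hx : x ∈ box d n) :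
    μ.real {f | δ * n < |((f x - f 0 : ℤ) : ℝ) - s (embed d x)|}
      ≤ 2 * Real.exp (-(δ ^ 2 / (2 * d * (d + 1) ^ 2) * n)) := by
  have := hμ.isProb
  rcases eq_or_ne x 0 with rfl | hx0
  · have hempty : {f : HeightFunction d | δ * n < |((f 0 - f 0 : ℤ) : ℝ) - s (embed d 0)|} = ∅ := by
      have hnonneg : 0 ≤ δ * n := by positivity
      simp [hnonneg.not_gt]
    rw [hempty, measureReal_empty]
    positivity
  have hdist : 0 < (latticeGraph d).dist 0 x :=
    (latticeGraph_connected d).pos_dist_of_ne hx0.symm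
  have hdist_le : ((latticeGraph d).dist 0 x : ℝ) ≤ d * n := by
    exact_mod_cast dist_zero_le_of_mem_box hx
  have hd : (0 : ℝ) < d * n := lt_of_lt_of_le (by exact_mod_cast hdist) hdist_le
  have htail := hμ.measureReal_le_abs_sub_le hdist (a := δ * n / (d + 1)) (by positivity)
  rw [sub_zero, mul_div_cancel₀ _ (by positivity)] at htail
  calc μ.real {f | δ * n < |((f x - f 0 : ℤ) : ℝ) - s (embed d x)|}
      ≤ μ.real {f | δ * n ≤ |((f x - f 0 : ℤ) : ℝ) - s (embed d x)|} :=
        measureReal_mono (Set.ofPred_subset_ofPred.mpr fun f => le_of_lt)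
    _ ≤ 2 * Real.exp (-((δ * n / (d + 1)) ^ 2 / (2 * (latticeGraph d).dist 0 x))) := htail
    _ ≤ 2 * Real.exp (-((δ * n / (d + 1)) ^ 2 / (2 * (d * n)))) := by
        have : (0 : ℝ) < (latticeGraph d).dist 0 x := by exact_mod_cast hdist
        gcongr
    _ = 2 * Real.exp (-(δ ^ 2 / (2 * d * (d + 1) ^ 2) * n)) := by
        have hd0 : (d : ℝ) ≠ 0 := left_ne_zero_of_mul hd.ne'
        have hn0 : (n : ℝ) ≠ 0 := right_ne_zero_of_mul hd.ne'
        congr 3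
        field_simp

lemma tendsto_pow_mul_exp_neg_mul {c : ℝ} (hc : 0 < c) (k : ℕ) :
    Tendsto (fun n : ℕ => (n : ℝ) ^ k * Real.exp (-(c * n))) atTop (𝓝 0) := by
  have hlim := ((Real.tendsto_pow_mul_exp_neg_atTop_nhds_zero k).comp
    (tendsto_natCast_atTop_atTop.const_mul_atTop hc)).const_mul (c ^ k)⁻¹
  rw [mul_zero] at hlim
  refine hlim.congr fun n => ?_
  rw [Function.comp_apply, mul_pow, mul_assoc, inv_mul_cancel_left₀ (by positivity)]

lemma IsConcentratedGibbs.concentratesOnSlope [NeZero d] (hμ : IsConcentratedGibbs μ s) :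
    ConcentratesOnSlope μ s := by
  intro δ hδ
  have hd : 0 < (d : ℝ) := Nat.cast_pos.mpr (NeZero.pos d)
  set c : ℝ := δ ^ 2 / (2 * d * (d + 1) ^ 2)
  have hlim := (tendsto_pow_mul_exp_neg_mul (c := c) (by positivity) d).const_mul (2 * 2 ^ d)
  rw [mul_zero] at hlim
  refine squeeze_zero (fun n => measureReal_nonneg) (fun n => ?_) hlim
  calc μ.real (deviation s n (δ * n))
      ≤ ∑ x ∈ box d n, μ.real {f | δ * n < |((f x - f 0 : ℤ) : ℝ) - s (embed d x)|} :=
        measureReal_biUnion_finset_le _ _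
    _ ≤ ∑ _x ∈ box d n, 2 * Real.exp (-(c * n)) :=
        Finset.sum_le_sum fun x hx => hμ.measureReal_lt_abs_sub_le hδ hx
    _ = 2 * 2 ^ d * ((n : ℝ) ^ d * Real.exp (-(c * n))) := by
        rw [Finset.sum_const, card_box, nsmul_eq_mul]
        push_cast
        ring

end Concentration

/-! ### Comparison of the surface tension with the mean logarithm -/

lemma ConcentratesOnSlope.tendsto_real_deviation_natFloor_mul {μ : Measure (HeightFunction d)}
    {s : Slope d} (hμ : ConcentratesOnSlope μ s) {δ a : ℝ} (hδ : 0 < δ) (ha : 0 < a) :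
    Tendsto (fun n : ℕ => μ.real (deviation s (⌊a * n⌋₊ + 1) (δ * (⌊a * n⌋₊ + 1)))
      * Real.log 2) atTop (𝓝 0) := by
  have h := ((hμ δ hδ).comp ((tendsto_add_atTop_nat 1).comp
    (tendsto_natFloor_mul_atTop ha))).mul_const (Real.log 2)
  simpa [Function.comp_def] using h

lemma div_le_div_add_mul_of_le {a b K p L : ℝ} (hK : 0 < K) (h : a ≤ b + p * (K * L)) :
    a / K ≤ b / K + p * L := by
  rw [div_add' _ _ _ hK.ne']
  gcongr
  linarith

section Comparison

variable [NeZero d] {μ : Measure (HeightFunction d)} [IsProbabilityMeasure μ] {s : Slope d}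
  {η : ℝ}

lemma log_numMod_box_le (n : ℕ) (f : Vertex d → ℤ) :
    Real.log (numMod (box d n) f) ≤ (2 * n : ℝ) ^ d * Real.log 2 := by
  simpa [card_box] using log_numMod_le (box d n) f

lemma meanLog_le_log_numMod_slopeFloor (hs : s ∈ lipSlopes d) (hη0 : 0 ≤ η)
    (hη : ∀ i, s (embed d (gen i)) + η ≤ 1) {m n : ℕ} (hnm : n ≤ m) {r : ℝ}
    (hr : r + (d + 1) ≤ η * (m - n - 1)) :
    meanLog μ n ≤ Real.log (numMod (box d m) (slopeFloor hs))
      + μ.real (deviation s (n + 1) r) * ((2 * m : ℝ) ^ d * Real.log 2) := by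
  have h := integral_le_integral_add_measureReal_mul (C := (2 * m : ℝ) ^ d * Real.log 2)
    (measurableSet_deviation s (n + 1) r)
    (integrable_log_numMod μ n)
    (integrable_const (Real.log (numMod (box d m) (slopeFloor hs)))) (fun f hf => ?_)
    (fun f _ => (log_numMod_box_le n f).trans (by gcongr)) (fun _ _ => Real.log_natCast_nonneg _)
  · simpa [meanLog] using h
  · rw [← numMod_normalize]
    refine Real.log_le_log (Nat.cast_pos.mpr (numMod_pos _ f.normalize.hasSteps)) ?_
    exact_mod_cast numMod_le_numMod_slopeFloor hs hη0 hη hnm fun x hx =>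
      (add_le_add_left (abs_normalize_sub_le hf hx) _).trans hr

lemma log_numMod_slopeFloor_le_meanLog (hs : s ∈ lipSlopes d) (hη0 : 0 ≤ η)
    (hη : ∀ i, s (embed d (gen i)) + η ≤ 1) {m n : ℕ} (hnm : n + 1 ≤ m) {r : ℝ}
    (hr : r + (d + 1) ≤ η * (m - n - 1)) :
    Real.log (numMod (box d n) (slopeFloor hs)) ≤ meanLog μ m
      + μ.real (deviation s (m + 1) r) * ((2 * n : ℝ) ^ d * Real.log 2) := by
  have h := integral_le_integral_add_measureReal_mul (measurableSet_deviation s (m + 1) r)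
    (integrable_const (Real.log (numMod (box d n) (slopeFloor hs))))
    (integrable_log_numMod μ m) (fun f hf => ?_)
    (fun f _ => log_numMod_box_le n _) (fun _ _ => Real.log_natCast_nonneg _)
  · simpa [meanLog] using h
  · rw [← numMod_normalize _ f]
    refine Real.log_le_log (Nat.cast_pos.mpr (numMod_pos _ (slopeFloor hs).hasSteps)) ?_
    exact_mod_cast numMod_slopeFloor_le_numMod hs hη0 hη hnm fun x hx =>
      (add_le_add_left (abs_normalize_sub_le hf hx) _).trans hr

lemma eventually_meanLog_le_log_numMod_slopeFloor (hs : s ∈ lipSlopes d) (hη0 : 0 < η)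
    (hη : ∀ i, s (embed d (gen i)) + η ≤ 1) {θ : ℝ} (hθ0 : 0 < θ) (hθ1 : θ < 1) :
    ∃ δ > 0, ∀ᶠ m : ℕ in atTop, meanLog μ ⌊θ * m⌋₊ / (2 * m) ^ d
      ≤ Real.log (numMod (box d m) (slopeFloor hs)) / (2 * m) ^ d
        + μ.real (deviation s (⌊θ * m⌋₊ + 1) (δ * (⌊θ * m⌋₊ + 1))) * Real.log 2 := by
  have hδ0 : 0 < η * (1 - θ) / 2 := half_pos (mul_pos hη0 (sub_pos.mpr hθ1))
  set δ : ℝ := η * (1 - θ) / 2 with hδ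
  refine ⟨δ, hδ0, ?_⟩
  filter_upwards [eventually_gt_atTop 0, eventually_le_mul_natCast hδ0 (δ + (d + 1) + η)]
    with m hm hlarge
  have hfloor : (⌊θ * m⌋₊ : ℝ) ≤ θ * m := Nat.floor_le (by positivity)
  have hle : (⌊θ * m⌋₊ : ℝ) ≤ m := hfloor.trans (mul_le_of_le_one_left m.cast_nonneg hθ1.le)
  have hr : δ * (⌊θ * m⌋₊ + 1) + (d + 1) ≤ η * (m - ⌊θ * m⌋₊ - 1) := by
    have h₁ : δ * ⌊θ * m⌋₊ ≤ δ * m := by gcongr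
    have h₂ : η * (m - θ * m) = 2 * (δ * m) := by rw [hδ]; ring
    have h₃ : η * (m - θ * m) ≤ η * (m - ⌊θ * m⌋₊) := by gcongr
    linarith
  exact div_le_div_add_mul_of_le (by positivity)
    (meanLog_le_log_numMod_slopeFloor hs hη0.le hη (by exact_mod_cast hle) hr)

lemma eventually_log_numMod_slopeFloor_le_meanLog (hs : s ∈ lipSlopes d) (hη0 : 0 < η)
    (hη : ∀ i, s (embed d (gen i)) + η ≤ 1) {κ : ℝ} (hκ : 1 < κ) :
    ∃ δ > 0, ∀ᶠ n : ℕ in atTop,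
      Real.log (numMod (box d n) (slopeFloor hs)) / (2 * n) ^ d
        ≤ meanLog μ ⌊κ * n⌋₊ / (2 * n) ^ d
          + μ.real (deviation s (⌊κ * n⌋₊ + 1) (δ * (⌊κ * n⌋₊ + 1))) * Real.log 2 := by
  have hκ0 : 0 < κ := one_pos.trans hκ
  have hκ1 : 0 < κ - 1 := sub_pos.mpr hκ
  have hδ0 : 0 < η * (κ - 1) / (2 * κ) := by positivity
  set δ : ℝ := η * (κ - 1) / (2 * κ) with hδ
  refine ⟨δ, hδ0, ?_⟩
  filter_upwards [eventually_gt_atTop 0, eventually_le_mul_natCast hκ1 2,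
    eventually_le_mul_natCast (mul_pos hδ0 hκ0) (δ + (d + 1) + 2 * η)] with n hn hlarge hlarge'
  have hfloor : (⌊κ * n⌋₊ : ℝ) ≤ κ * n := Nat.floor_le (by positivity)
  have hfloor' : κ * n < ⌊κ * n⌋₊ + 1 := Nat.lt_floor_add_one _
  have hle : ((n + 1 : ℕ) : ℝ) ≤ ⌊κ * n⌋₊ := by push_cast; linarith
  have hr : δ * (⌊κ * n⌋₊ + 1) + (d + 1) ≤ η * (⌊κ * n⌋₊ - n - 1) := by
    have h₁ : δ * ⌊κ * n⌋₊ ≤ δ * (κ * n) := by gcongr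
    have h₂ : η * (κ * n - n) = 2 * (δ * κ * n) := by rw [hδ]; field_simp
    have h₃ : η * (κ * n - 1 - n - 1) ≤ η * (⌊κ * n⌋₊ - n - 1) := by
      gcongr
      linarith
    linarith
  exact div_le_div_add_mul_of_le (by positivity)
    (log_numMod_slopeFloor_le_meanLog hs hη0.le hη (by exact_mod_cast hle) hr)

lemma ConcentratesOnSlope.tendsto_log_numMod_slopeFloor (hμ : ConcentratesOnSlope μ s)
    (hs : s ∈ lipSlopes d) (hlt : ∀ i, s (embed d (gen i)) < 1) {t : ℝ}
    (ht : Tendsto (fun n : ℕ => meanLog μ n / (2 * n) ^ d) atTop (𝓝 t)) :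
    Tendsto (fun n : ℕ => Real.log (numMod (box d n) (slopeFloor hs)) / (2 * n) ^ d) atTop
      (𝓝 t) := by
  obtain ⟨j, hj⟩ := Finite.exists_max fun i : Fin (d + 1) => s (embed d (gen i))
  have hη0 : 0 < 1 - s (embed d (gen j)) := sub_pos.mpr (hlt j)
  have hη (i : Fin (d + 1)) : s (embed d (gen i)) + (1 - s (embed d (gen j))) ≤ 1 := by
    linarith [hj i]
  refine tendsto_of_natFloor_bounds ht (fun θ hθ0 hθ1 => ?_) (fun κ hκ => ?_)
  · obtain ⟨δ, hδ, hle⟩ :=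
      eventually_meanLog_le_log_numMod_slopeFloor (μ := μ) hs hη0 hη hθ0 hθ1
    exact ⟨_, hμ.tendsto_real_deviation_natFloor_mul hδ hθ0, hle⟩
  · obtain ⟨δ, hδ, hle⟩ :=
      eventually_log_numMod_slopeFloor_le_meanLog (μ := μ) hs hη0 hη hκ
    exact ⟨_, hμ.tendsto_real_deviation_natFloor_mul hδ (one_pos.trans hκ), hle⟩

end Comparison

/-! ### Extremal slopes -/

section Extremal

variable {μ : Measure (HeightFunction d)} {s : Slope d} {i : Fin (d + 1)}

lemma slopeFloor_step_eq_one (hs : s ∈ lipSlopes d) (hi : s (embed d (gen i)) = 1)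
    (x : Vertex d) : slopeFloor hs (x + gen i) - slopeFloor hs x = 1 := by
  refine ((slopeFloor hs).grad x i).resolve_right fun h => ?_
  have hlt := lt_floorVal (fun x => s (embed d x)) (x + gen i)
  have hle := floorVal_le (fun x => s (embed d x)) x
  have hstep : (floorVal (fun x => s (embed d x)) (x + gen i) : ℝ)
      - floorVal (fun x => s (embed d x)) x = -d := by exact_mod_cast h
  simp only [map_add, hi] at hlt
  linarith

lemma integrable_sub [IsFiniteMeasure μ] (x y : Vertex d) :
    Integrable (fun f : HeightFunction d => ((f y - f x : ℤ) : ℝ)) μ := by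
  refine Integrable.of_bound ((measurable_from_top (f := fun k : ℤ => (k : ℝ))).comp
    (measurable_sub y x)).aestronglyMeasurable (d * (latticeGraph d).dist x y)
    (Eventually.of_forall fun f => ?_)
  rw [Real.norm_eq_abs, ← Int.cast_abs]
  exact_mod_cast f.hasSteps.abs_sub_le_mul_dist x y

lemma HasSlope.integral_step_eq [IsFiniteMeasure μ] (hμ : HasSlope μ s) (x : Vertex d)
    (i : Fin (d + 1)) :
    ∫ f : HeightFunction d, ((f (x + gen i) - f x : ℤ) : ℝ) ∂μ = s (embed d (gen i)) :=
  calc ∫ f : HeightFunction d, ((f (x + gen i) - f x : ℤ) : ℝ) ∂μ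
      = ∫ f : HeightFunction d, (((f (x + gen i) - f 0 : ℤ) : ℝ) - ((f x - f 0 : ℤ) : ℝ)) ∂μ := by
        simp
    _ = s (embed d (gen i)) := by
        rw [integral_sub (integrable_sub _ _) (integrable_sub _ _), ← hμ, ← hμ, map_add, map_add,
          add_sub_cancel_left]

lemma HasSlope.ae_step_eq_one [IsProbabilityMeasure μ] (hμ : HasSlope μ s)
    (hi : s (embed d (gen i)) = 1) : ∀ᵐ f ∂μ, ∀ x, f (x + gen i) - f x = 1 := by
  refine ae_all_iff.mpr fun x => ?_
  have hle (f : HeightFunction d) : ((f (x + gen i) - f x : ℤ) : ℝ) ≤ 1 := by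
    have : f (x + gen i) - f x ≤ 1 := by rcases f.grad x i with h | h <;> omega
    exact_mod_cast this
  have heq := (integral_eq_iff_of_ae_le (integrable_sub x (x + gen i)) (integrable_const 1)
    (Eventually.of_forall hle)).mp ((hμ.integral_step_eq x i).trans (by simp [hi]))
  filter_upwards [heq] with f hf
  exact_mod_cast (hf : ((f (x + gen i) - f x : ℤ) : ℝ) = 1)

lemma HasSlope.meanLog_eq_zero [NeZero d] [IsProbabilityMeasure μ] (hμ : HasSlope μ s)
    (hi : s (embed d (gen i)) = 1) (n : ℕ) : meanLog μ n = 0 := by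
  refine integral_eq_zero_of_ae ?_
  filter_upwards [hμ.ae_step_eq_one hi] with f hf
  rw [numMod_eq_one_of_step_eq_one _ f.hasSteps hf, Nat.cast_one, Real.log_one, Pi.zero_apply]

lemma log_numMod_slopeFloor_eq_zero [NeZero d] (hs : s ∈ lipSlopes d)
    (hi : s (embed d (gen i)) = 1) (R : Finset (Vertex d)) :
    Real.log (numMod R (slopeFloor hs)) = 0 := by
  rw [numMod_eq_one_of_step_eq_one _ (slopeFloor hs).hasSteps (slopeFloor_step_eq_one hs hi),
    Nat.cast_one, Real.log_one]

end Extremal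

/-! ### The surface tension -/

lemma tensionSeq_eq [NeZero d] {s : Slope d} (hs : s ∈ lipSlopes d) (n : ℕ) :
    tensionSeq s hs n = -(Real.log (numMod (box d n) (slopeFloor hs)) / (2 * n) ^ d) := by
  rw [tensionSeq, ncard_fixedBdry, card_box]
  push_cast
  ring

theorem tendsto_tensionSeq [NeZero d] {s : Slope d} (hs : s ∈ lipSlopes d)
    {μ : Measure (HeightFunction d)} [IsProbabilityMeasure μ] (hslope : HasSlope μ s)
    (hconc : ConcentratesOnSlope μ s) {t : ℝ}
    (ht : Tendsto (fun n : ℕ => meanLog μ n / (2 * n) ^ d) atTop (𝓝 t)) :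
    Tendsto (tensionSeq s hs) atTop (𝓝 (-t)) := by
  simp only [funext (tensionSeq_eq hs)]
  refine Tendsto.neg ?_
  by_cases hlt : ∀ i, s (embed d (gen i)) < 1
  · exact hconc.tendsto_log_numMod_slopeFloor hs hlt ht
  · push Not at hlt
    obtain ⟨i, hi⟩ := hlt
    have hi : s (embed d (gen i)) = 1 := (hs i).antisymm hi
    simpa only [hslope.meanLog_eq_zero hi, log_numMod_slopeFloor_eq_zero hs hi] using ht

end Stepped

end

theorem mainTheorem8_general (d : ℕ) [NeZero d] (s : Stepped.Slope d)
    (hs : s ∈ Stepped.lipSlopes d) (μ : Measure (Stepped.HeightFunction d))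
    [IsProbabilityMeasure μ] (hshift : Stepped.IsShiftInvariant μ)
    (hgibbs : Stepped.IsGradientGibbs μ) (hslope : Stepped.HasSlope μ s)
    (hconc : Stepped.ConcentratesOnSlope μ s) :
    Tendsto (Stepped.tensionSeq s hs) atTop (𝓝 (Stepped.surfaceTension s hs)) ∧
      Stepped.specificEntropy μ = Stepped.surfaceTension s hs := by
  obtain ⟨t, ht⟩ := Stepped.exists_tendsto_meanLog hshift
  have htension := Stepped.tendsto_tensionSeq hs hslope hconc ht
  have hσ : Stepped.surfaceTension s hs = -t := htension.limUnder_eq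
  rw [hσ]
  exact ⟨htension, Stepped.specificEntropy_eq_of_tendsto (hgibbs.tendsto_entropyIn_box ht)⟩

theorem mainTheorem8 (d : ℕ) (hd : 2 ≤ d) (s : Stepped.Slope d) (hs : s ∈ Stepped.lipSlopes d)
    (μ : Measure (Stepped.HeightFunction d)) (hμ : Stepped.IsConcentratedGibbs μ s) :
    Tendsto (Stepped.tensionSeq s hs) atTop (𝓝 (Stepped.surfaceTension s hs)) ∧
      Stepped.specificEntropy μ = Stepped.surfaceTension s hs := by
  have : NeZero d := ⟨by omega⟩
  have := hμ.isProb
  exact mainTheorem8_general d s hs μ hμ.shiftInvariant hμ.gibbs hμ.slope hμ.concentratesOnSlope
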